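/- Consider operators on exactly three qubits (no ancillae), with computational basis $|a,b,c\rangle$, $a,b,c\in\{0,1\}$. For distinct qubits $i,j,k$ let $\mathrm{CX}^{(i;j)}$ be the $\mathrm{CNOT}$ with control $i$ and target $j$, let $\mathrm{CCX}^{(i,j;k)}$ be the $\mathrm{TOFFOLI}$ with controls $i,j$ and target $k$, and let $\mathrm{CZ}^{(i,j)}$ be the controlled-$Z$ on qubits $i,j$. For an operator $U$, its $\mathrm{CZ}$-cost $|U|_{\mathrm{CZ}}$ is the minimum number of $\mathrm{CZ}$ gates in a three-qubit circuit, consisting only of $\mathrm{CZ}$ gates and arbitrary one-qubit unitary gates, whose product of gates equals $U$; the $\mathrm{CNOT}$-cost $|U|_{\mathrm{CNOT}}$ is defined in the same way with $\mathrm{CNOT}$ gates in place of $\mathrm{CZ}$ gates. Let $(\ell,m,n)$ be any ordering of the three qubits, and let $\mathrm{PERES}^{(\ell;m;n)}=\mathrm{CX}^{(\ell;m)}\cdot\mathrm{CCX}^{(\ell,m;n)}$, where operators act on vectors from the left, so that the $\mathrm{TOFFOLI}$ is applied first: on the bits of the qubits $\ell,m,n$ it acts by $|a,b,c\rangle\mapsto|a,\,a\oplus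 b,\,c\oplus ab\rangle$. Then $$|\mathrm{PERES}^{(\ell;m;n)}|_{\mathrm{CZ}}=|\mathrm{PERES}^{(\ell;m;n)}|_{\mathrm{CNOT}}=5 .$$ -/

import Mathlib

/-- Linear operators on `N` qubits, as matrices in the computational basis. The basis vectors
`|x⟩` are indexed by bit strings `x : Fin N → Fin 2` (addition and multiplication in `Fin 2` are
exclusive-or and conjunction), and the entry in row `x` and column `y` is `⟨x| U |y⟩`. -/
abbrev QOp (N : ℕ) : Type := Matrix (Fin N → Fin 2) (Fin N → Fin 2) ℂ

namespace QOp

variable {N : ℕ}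

/-- The one-qubit operator `g` applied to the qubit `q`, with the identity on every other qubit. -/
def onQubit (q : Fin N) (g : Matrix (Fin 2) (Fin 2) ℂ) : QOp N :=
  Matrix.of fun x y => if ∀ k, k ≠ q → x k = y k then g (x q) (y q) else 0

/-- The operator sending each basis vector `|y⟩` to the basis vector `|f y⟩`. -/
def ofMap (f : (Fin N → Fin 2) → (Fin N → Fin 2)) : QOp N :=
  Matrix.of fun x y => if x = f y then 1 else 0

/-- The controlled-`Z` on the qubits `i` and `j`: the sign `-1` exactly when both bits are `1`. -/
def CZ (i j : Fin N) : QOp N :=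
  Matrix.diagonal fun x => if x i = 1 ∧ x j = 1 then -1 else 1

/-- The controlled-`X` (`CNOT`) with control `i` and target `j`. -/
def CX (i j : Fin N) : QOp N :=
  ofMap fun y => Function.update y j (y j + y i)

/-- The controlled-controlled-`X` (`TOFFOLI`) with controls `i`, `j` and target `k`. -/
def CCX (i j k : Fin N) : QOp N :=
  ofMap fun y => Function.update y k (y k + y i * y j)

/-- The `PERES` operator `CX⁽ˡ;ᵐ⁾ · CCX⁽ˡ,ᵐ;ⁿ⁾`. Operators act on vectors from the left, so the
`TOFFOLI` is applied first. -/
def PERES (l m n : Fin N) : QOp N :=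
  CX l m * CCX l m n

end QOp

/-- The gates of circuits on `N` qubits: arbitrary one-qubit unitaries, `CZ` and `CNOT`. -/
inductive QGate (N : ℕ) : Type
  | single (q : Fin N) (g : Matrix.unitaryGroup (Fin 2) ℂ) : QGate N
  | cz (i j : Fin N) (h : i ≠ j) : QGate N
  | cnot (control target : Fin N) (h : control ≠ target) : QGate N

namespace QGate

variable {N : ℕ}

/-- The `N`-qubit operator implemented by a gate. -/
def toOp : QGate N → QOp N
  | single q g => QOp.onQubit q (g : Matrix (Fin 2) (Fin 2) ℂ)
  | cz i j _ => QOp.CZ i j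
  | cnot i j _ => QOp.CX i j

def isSingle : QGate N → Bool
  | single _ _ => true
  | _ => false

def isCZ : QGate N → Bool
  | cz _ _ _ => true
  | _ => false

def isCNOT : QGate N → Bool
  | cnot _ _ _ => true
  | _ => false

end QGate

/-- A circuit on `N` qubits, without further (ancilla) qubits: a finite list of gates. -/
abbrev QCircuit (N : ℕ) : Type := List (QGate N)

namespace QCircuit

variable {N : ℕ}

/-- The operator computed by a circuit: the product of its gates. -/
def toOp (c : QCircuit N) : QOp N := (c.map QGate.toOp).prod

/-- A `CZ`-circuit consists of one-qubit gates and `CZ` gates only. -/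
def IsCZCircuit (c : QCircuit N) : Prop := ∀ g ∈ c, g.isSingle ∨ g.isCZ

/-- A `CNOT`-circuit consists of one-qubit gates and `CNOT` gates only. -/
def IsCNOTCircuit (c : QCircuit N) : Prop := ∀ g ∈ c, g.isSingle ∨ g.isCNOT

/-- The number of `CZ` gates in a circuit. -/
def numCZ (c : QCircuit N) : ℕ := c.countP QGate.isCZ

/-- The number of `CNOT` gates in a circuit. -/
def numCNOT (c : QCircuit N) : ℕ := c.countP QGate.isCNOT

end QCircuit

/-- The `CZ`-cost of an `N`-qubit operator `U`: the minimum number of `CZ` gates in an `N`-qubit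
`CZ`-circuit that computes `U` (it is `⊤` if there is no such circuit). -/
noncomputable def czCost {N : ℕ} (U : QOp N) : ℕ∞ :=
  ⨅ (c : QCircuit N) (_ : c.IsCZCircuit ∧ c.toOp = U), (c.numCZ : ℕ∞)

/-- The `CNOT`-cost of an `N`-qubit operator `U`: the minimum number of `CNOT` gates in an
`N`-qubit `CNOT`-circuit that computes `U` (it is `⊤` if there is no such circuit). -/
noncomputable def cnotCost {N : ℕ} (U : QOp N) : ℕ∞ :=
  ⨅ (c : QCircuit N) (_ : c.IsCNOTCircuit ∧ c.toOp = U), (c.numCNOT : ℕ∞)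

/-! Upper bound. A Hadamard gate on `n` before and after turns the Peres operator into a CNOT times
a doubly controlled `Z` (`peresZ`). The sign of the latter is a product of eighth-root phases in the
seven parities of the bits. Collecting these phases takes five CNOTs, because the CNOT that produces
the parity of `l` and `m` already belongs to the operator (`peresZ_eq`). CNOT and CZ differ by
Hadamard gates, so CNOT circuits become CZ circuits of equal count; this handles both costs.

Lower bound. Let x, y, z count the CZ gates on the pairs lm, ln, mn. Single out one qubit and regard
the circuit as alternating between layers that do not couple it to the others and controlled `Z`s
that do (`Layered`). With at most two couplings the operator is a `sandwich`, and comparing its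
blocks with those of `peresZ` gives x + y ≥ 2 from qubit `l` (`two_le_add`), y + z ≥ 3 from qubit
`n` (`three_le_of_cx_cz`), x + z ≥ 3 from qubit `m` (`three_le_of_isFlipMultiplexer`). The sum is
2(x + y + z) ≥ 8, so fewer than five gates means x = y = 1 and z = 2. But when x = y = 1, each of
the three layers seen from `l` must be nonlocal, which forces z ≥ 3 (`three_le_of_xcz`).

The obstructions come from traces, determinants and squares of conjugates of `Z`, which are
traceless involutions. Unitarity of the gates is used only through invertibility. -/

open Matrix Kronecker

/-! ### Block calculus relative to a distinguished qubit -/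

section Blocks

variable {ι : Type*} [Fintype ι] [DecidableEq ι]

/-- The block in row `a` and column `b` of an operator on a qubit and a further system. -/
def qblock (a b : Fin 2) (M : Matrix (Fin 2 × ι) (Fin 2 × ι) ℂ) : Matrix ι ι ℂ :=
  M.submatrix (Prod.mk a) (Prod.mk b)

/-- The operator `X` controlled by a qubit. -/
def ctl (X : Matrix ι ι ℂ) : Matrix (Fin 2 × ι) (Fin 2 × ι) ℂ :=
  Matrix.of fun p q => if p.1 = q.1 then (X ^ (p.1 : ℕ)) p.2 q.2 else 0

omit [DecidableEq ι] in
lemma qblock_mul (a b : Fin 2) (M N : Matrix (Fin 2 × ι) (Fin 2 × ι) ℂ) :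
    qblock a b (M * N) = ∑ c, qblock a c M * qblock c b N := by
  ext i j
  simp [qblock, Matrix.mul_apply, Fintype.sum_prod_type, Matrix.sum_apply]

omit [Fintype ι] [DecidableEq ι] in
lemma qblock_kronecker (a b : Fin 2) (u : Matrix (Fin 2) (Fin 2) ℂ) (A : Matrix ι ι ℂ) :
    qblock a b (u ⊗ₖ A) = u a b • A := by
  ext i j
  simp [qblock, Matrix.kroneckerMap_apply]

lemma qblock_ctl (a b : Fin 2) (X : Matrix ι ι ℂ) :
    qblock a b (ctl X) = if a = b then X ^ (a : ℕ) else 0 := by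
  ext i j
  by_cases h : a = b <;> simp [qblock, ctl, h]

/-- An operator that uses two controlled operators on the distinguished qubit. -/
def sandwich (u₂ : Matrix (Fin 2) (Fin 2) ℂ) (A X : Matrix ι ι ℂ) (u₁ : Matrix (Fin 2) (Fin 2) ℂ)
    (B Y : Matrix ι ι ℂ) (u₀ : Matrix (Fin 2) (Fin 2) ℂ) (C : Matrix ι ι ℂ) :
    Matrix (Fin 2 × ι) (Fin 2 × ι) ℂ :=
  (u₂ ⊗ₖ A) * (ctl X * ((u₁ ⊗ₖ B) * (ctl Y * (u₀ ⊗ₖ C))))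

/-- Multiplying on the right by `w ⊗ 1` cancels `u₀`. Column `j` then fixes the control bit of `ctl
Y`, while `ctl X` contributes a term `1` and a term `X`. -/
lemma qblock_sandwich {u₂ u₁ u₀ w : Matrix (Fin 2) (Fin 2) ℂ} {A X B Y C : Matrix ι ι ℂ}
    (hw : u₀ * w = 1) (a j : Fin 2) :
    w 0 j • qblock a 0 (sandwich u₂ A X u₁ B Y u₀ C) +
      w 1 j • qblock a 1 (sandwich u₂ A X u₁ B Y u₀ C) =
    A * ((u₂ a 0 * u₁ 0 j) • (1 : Matrix ι ι ℂ) + (u₂ a 1 * u₁ 1 j) • X) *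
      (B * Y ^ (j : ℕ) * C) := by
  have h1 : sandwich u₂ A X u₁ B Y u₀ C * (w ⊗ₖ (1 : Matrix ι ι ℂ)) =
      (u₂ ⊗ₖ A) * (ctl X * ((u₁ ⊗ₖ B) * (ctl Y * ((1 : Matrix (Fin 2) (Fin 2) ℂ) ⊗ₖ C)))) := by
    simp only [sandwich, Matrix.mul_assoc, ← Matrix.mul_kronecker_mul, hw, Matrix.mul_one]
  have h2 := congrArg (qblock a j) h1
  rw [qblock_mul] at h2
  simp only [qblock_kronecker, Fin.sum_univ_two, Matrix.mul_smul, Matrix.mul_one] at h2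
  rw [h2]
  fin_cases j <;>
  simp [qblock_mul, qblock_kronecker, qblock_ctl, Fin.sum_univ_two, Matrix.mul_add, Matrix.add_mul,
    Matrix.mul_assoc, smul_smul, mul_comm (u₁ _ _)]

/-- Exchanges the outer gates, so that facts about `u₀` carry over to `u₂`. -/
lemma sandwich_transpose (u₂ u₁ u₀ : Matrix (Fin 2) (Fin 2) ℂ) (A X B Y C : Matrix ι ι ℂ) :
    (sandwich u₂ A X u₁ B Y u₀ C)ᵀ = sandwich u₀ᵀ Cᵀ Yᵀ u₁ᵀ Bᵀ Xᵀ u₂ᵀ Aᵀ := by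
  have hc : ∀ X : Matrix ι ι ℂ, (ctl X)ᵀ = ctl Xᵀ := by
    intro X
    ext ⟨a, i⟩ ⟨b, j⟩
    by_cases h : a = b
    · subst h; simp [ctl, ← Matrix.transpose_pow]
    · simp [ctl, h, Ne.symm h]
  simp only [sandwich, Matrix.transpose_mul, hc, ← Matrix.kroneckerMap_transpose, Matrix.mul_assoc]

end Blocks

/-! ### Invertible two-by-two matrices and traceless involutions -/

section TwoByTwo

lemma fin_two_diag_or_antidiag {w : Matrix (Fin 2) (Fin 2) ℂ} (hw : IsUnit w)
    (h : ∀ j, w 0 j * w 1 j = 0) :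
    (w 0 0 ≠ 0 ∧ w 1 1 ≠ 0 ∧ w 0 1 = 0 ∧ w 1 0 = 0) ∨
      (w 0 0 = 0 ∧ w 1 1 = 0 ∧ w 0 1 ≠ 0 ∧ w 1 0 ≠ 0) := by
  have hd : w 0 0 * w 1 1 - w 0 1 * w 1 0 ≠ 0 := by
    rw [← Matrix.det_fin_two]
    exact ((Matrix.isUnit_iff_isUnit_det w).1 hw).ne_zero
  have h0 := h 0
  have h1 := h 1
  grind

end TwoByTwo

section Involutions

variable {ι : Type*} [Fintype ι] [DecidableEq ι]

lemma conj_involution {A A' X : Matrix ι ι ℂ} (hA : A' * A = 1) (hX : X * X = 1) :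
    (A * X * A') * (A * X * A') = 1 := by
  have hA2 : A * A' = 1 := mul_eq_one_comm.1 hA
  calc A * X * A' * (A * X * A') = A * X * (A' * A) * X * A' := by simp only [Matrix.mul_assoc]
    _ = A * (X * X) * A' := by rw [hA]; simp only [Matrix.mul_assoc, Matrix.one_mul]
    _ = 1 := by rw [hX, Matrix.mul_one, hA2]

lemma trace_conj {A A' : Matrix ι ι ℂ} (hA : A' * A = 1) (X : Matrix ι ι ℂ) :
    (A * X * A').trace = X.trace := by
  rw [Matrix.trace_mul_comm, ← Matrix.mul_assoc, hA, Matrix.one_mul]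

lemma coeffs_eq_zero [Nonempty ι] {X : Matrix ι ι ℂ} (hX : X * X = 1) (htr : X.trace = 0)
    {α β : ℂ} (h : α • (1 : Matrix ι ι ℂ) + β • X = 0) : α = 0 ∧ β = 0 := by
  have hα : α = 0 := by
    have := congrArg Matrix.trace h
    simpa [htr] using this
  refine ⟨hα, ?_⟩
  subst hα
  have h2 := congrArg (· * X) h
  simp only [zero_smul, zero_add, Matrix.smul_mul, hX, Matrix.zero_mul] at h2
  simpa using h2

lemma span_mul_conj {X : Matrix ι ι ℂ} (hX : X * X = 1) (α β : ℂ) :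
    (α • (1 : Matrix ι ι ℂ) + β • X) * (α • (1 : Matrix ι ι ℂ) - β • X) =
      (α ^ 2 - β ^ 2) • (1 : Matrix ι ι ℂ) := by
  simp only [Matrix.add_mul, Matrix.mul_sub, Matrix.smul_mul, Matrix.mul_smul, Matrix.one_mul,
    Matrix.mul_one, hX]
  module

end Involutions

/-! ### Block-diagonal operators with two couplings -/

section BlockDiagonal

variable {ι : Type*} [Fintype ι] [DecidableEq ι] [Nonempty ι]

/-- `V₁ V₀⁻¹` is not in the span of the identity and a traceless involution. -/
def AvoidsInvolutionSpan (V₀ V₁ : Matrix ι ι ℂ) : Prop :=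
  ∀ (K : Matrix ι ι ℂ) (α β : ℂ), K * K = 1 → K.trace = 0 →
    V₁ ≠ (α • (1 : Matrix ι ι ℂ) + β • K) * V₀

/-- If both weights were nonzero, `V₁ V₀⁻¹` would be a multiple of `A (α₁ + β₁ X) (α₀ + β₀ X)⁻¹
A⁻¹`. The inverse is a multiple of `α₀ - β₀ X`, so this lies in the span of `1` and the traceless
involution `A X A⁻¹`. -/
lemma AvoidsInvolutionSpan.mul_eq_zero {V₀ V₁ A X G : Matrix ι ι ℂ}
    (h : AvoidsInvolutionSpan V₀ V₁) (hV₀ : IsUnit V₀) (hA : IsUnit A) (hX : X * X = 1)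
    (htr : X.trace = 0) {w₀ w₁ α₀ β₀ α₁ β₁ : ℂ}
    (h₀ : w₀ • V₀ = A * (α₀ • (1 : Matrix ι ι ℂ) + β₀ • X) * G)
    (h₁ : w₁ • V₁ = A * (α₁ • (1 : Matrix ι ι ℂ) + β₁ • X) * G) : w₀ * w₁ = 0 := by
  by_contra hne
  obtain ⟨hw₀, hw₁⟩ := mul_ne_zero_iff.1 hne
  obtain ⟨A', hA'⟩ := hA.exists_left_inv
  have hM := span_mul_conj hX α₀ β₀
  have hM' := span_mul_conj hX α₀ (-β₀)
  simp only [neg_smul, sub_neg_eq_add, ← sub_eq_add_neg, neg_sq] at hM'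
  have hunit : IsUnit (α₀ • (1 : Matrix ι ι ℂ) + β₀ • X) := by
    have h2 : IsUnit (w₀ • V₀) := hV₀.smul (Units.mk0 w₀ hw₀)
    rw [h₀] at h2
    simp only [Matrix.isUnit_iff_isUnit_det, IsUnit.mul_iff] at h2 ⊢
    exact h2.1.2
  have hδ : α₀ ^ 2 - β₀ ^ 2 ≠ 0 := by
    intro hδ
    rw [hδ, zero_smul, hunit.mul_right_eq_zero] at hM
    obtain ⟨h1, h2⟩ := coeffs_eq_zero (α := α₀) (β := -β₀) hX htr (by
      rw [← hM]; module)
    rw [h1, neg_eq_zero.1 h2] at hunit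
    simp at hunit
  have hAG : (α₀ ^ 2 - β₀ ^ 2) • (A * G) =
      w₀ • (A * (α₀ • (1 : Matrix ι ι ℂ) - β₀ • X) * A' * V₀) := by
    rw [← Matrix.mul_smul _ w₀ V₀, h₀]
    calc (α₀ ^ 2 - β₀ ^ 2) • (A * G) = A * ((α₀ ^ 2 - β₀ ^ 2) • (1 : Matrix ι ι ℂ)) * G := by simp
      _ = A * (α₀ • (1 : Matrix ι ι ℂ) - β₀ • X) * (A' * A) *
          (α₀ • (1 : Matrix ι ι ℂ) + β₀ • X) * G := by
        rw [← hM', hA']; simp only [Matrix.mul_assoc, Matrix.one_mul]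
      _ = _ := by simp only [Matrix.mul_assoc]
  refine h (A * X * A') (w₁⁻¹ * (α₀ ^ 2 - β₀ ^ 2)⁻¹ * w₀ * (α₁ * α₀ - β₁ * β₀))
    (w₁⁻¹ * (α₀ ^ 2 - β₀ ^ 2)⁻¹ * w₀ * (β₁ * α₀ - α₁ * β₀))
    (conj_involution hA' hX) ((trace_conj hA' X).trans htr) ?_
  have hspan : A * (α₁ • (1 : Matrix ι ι ℂ) + β₁ • X) * A' *
      (A * (α₀ • (1 : Matrix ι ι ℂ) - β₀ • X) * A') =
      (α₁ * α₀ - β₁ * β₀) • (1 : Matrix ι ι ℂ) + (β₁ * α₀ - α₁ * β₀) • (A * X * A') := by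
    calc _ = A * (α₁ • (1 : Matrix ι ι ℂ) + β₁ • X) * (A' * A) *
          (α₀ • (1 : Matrix ι ι ℂ) - β₀ • X) * A' := by simp only [Matrix.mul_assoc]
      _ = A * ((α₁ • (1 : Matrix ι ι ℂ) + β₁ • X) * (α₀ • (1 : Matrix ι ι ℂ) - β₀ • X)) * A' := by
        rw [hA']; simp only [Matrix.mul_assoc, Matrix.one_mul]
      _ = A * ((α₁ * α₀ - β₁ * β₀) • (1 : Matrix ι ι ℂ) + (β₁ * α₀ - α₁ * β₀) • X) * A' := by
        congr 2
        simp only [Matrix.add_mul, Matrix.mul_sub, Matrix.smul_mul, Matrix.mul_smul,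
          Matrix.one_mul, Matrix.mul_one, hX]
        module
      _ = _ := by
        simp only [Matrix.mul_add, Matrix.add_mul, Matrix.smul_mul, Matrix.mul_smul,
          Matrix.mul_one, mul_eq_one_comm.1 hA']
  have hG : w₁ • V₁ = A * (α₁ • (1 : Matrix ι ι ℂ) + β₁ • X) * A' * (A * G) := by
    rw [h₁]
    simp only [Matrix.mul_assoc]
    rw [← Matrix.mul_assoc A' A G, hA', Matrix.one_mul]
  have hAG' : A * G = ((α₀ ^ 2 - β₀ ^ 2)⁻¹ * w₀) •
      (A * (α₀ • (1 : Matrix ι ι ℂ) - β₀ • X) * A' * V₀) := by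
    rw [← smul_smul, ← hAG, inv_smul_smul₀ hδ]
  rw [← inv_smul_smul₀ hw₁ V₁, hG, hAG', Matrix.mul_smul, ← Matrix.mul_assoc, hspan,
    smul_smul, ← Matrix.smul_mul, smul_add, smul_smul, smul_smul]
  simp only [mul_assoc]

/-- The columns `i` and `j` of `q` are nonzero, so each row of `p` contains a zero. -/
lemma fin_two_cross {p q : Matrix (Fin 2) (Fin 2) ℂ} (hp : IsUnit p) (hq : IsUnit q)
    {i j : Fin 2} (hij : i ≠ j) (h1 : p 1 0 * q 0 i = 0) (h2 : p 1 1 * q 1 i = 0)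
    (h3 : p 0 0 * q 0 j = 0) (h4 : p 0 1 * q 1 j = 0) :
    (p 1 0 = 0 ∧ p 0 1 = 0) ∨ (p 0 0 = 0 ∧ p 1 1 = 0) := by
  have hd : p 0 0 * p 1 1 - p 0 1 * p 1 0 ≠ 0 := by
    rw [← Matrix.det_fin_two]
    exact ((Matrix.isUnit_iff_isUnit_det p).1 hp).ne_zero
  have hd' : q 0 0 * q 1 1 - q 0 1 * q 1 0 ≠ 0 := by
    rw [← Matrix.det_fin_two]
    exact ((Matrix.isUnit_iff_isUnit_det q).1 hq).ne_zero
  fin_cases i <;> fin_cases j <;> simp at hij h1 h2 h3 h4 <;> grind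

omit [Nonempty ι] in
lemma eq_smul_of_snd_eq_zero {w α β : ℂ} (hw : w ≠ 0) {V A X G : Matrix ι ι ℂ}
    (h : w • V = A * (α • (1 : Matrix ι ι ℂ) + β • X) * G) (hβ : β = 0) :
    ∃ r : ℂ, V = r • (A * G) := by
  refine ⟨w⁻¹ * α, ?_⟩
  rw [← inv_smul_smul₀ hw V, h, hβ]
  simp [smul_smul]

omit [Nonempty ι] in
lemma eq_smul_of_fst_eq_zero {w α β : ℂ} (hw : w ≠ 0) {V A X G : Matrix ι ι ℂ}
    (h : w • V = A * (α • (1 : Matrix ι ι ℂ) + β • X) * G) (hα : α = 0) :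
    ∃ r : ℂ, V = r • (A * X * G) := by
  refine ⟨w⁻¹ * β, ?_⟩
  rw [← inv_smul_smul₀ hw V, h, hα]
  simp [smul_smul]

/-- By `mul_eq_zero`, `u₀⁻¹` is diagonal or antidiagonal, and the vanishing off-diagonal blocks
force the same for `u₂`. An antidiagonal gate only flips a control, which is absorbed as a factor
`X` in `A` or `Y` in `C`. -/
theorem AvoidsInvolutionSpan.sandwich_form {V₀ V₁ A X B Y C : Matrix ι ι ℂ}
    {u₂ u₁ u₀ : Matrix (Fin 2) (Fin 2) ℂ}
    (h : AvoidsInvolutionSpan V₀ V₁) (hV₀ : IsUnit V₀)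
    (h₀₀ : qblock 0 0 (sandwich u₂ A X u₁ B Y u₀ C) = V₀)
    (h₁₁ : qblock 1 1 (sandwich u₂ A X u₁ B Y u₀ C) = V₁)
    (h₀₁ : qblock 0 1 (sandwich u₂ A X u₁ B Y u₀ C) = 0)
    (h₁₀ : qblock 1 0 (sandwich u₂ A X u₁ B Y u₀ C) = 0)
    (hu₂ : IsUnit u₂) (hu₁ : IsUnit u₁) (hu₀ : IsUnit u₀) (hA : IsUnit A) (hB : IsUnit B)
    (hC : IsUnit C) (hX : X * X = 1) (htr : X.trace = 0) (hY : Y * Y = 1) :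
    ∃ (A' C' : Matrix ι ι ℂ) (r s : ℂ), (A' = A ∨ A' = A * X) ∧ (C' = C ∨ C' = Y * C) ∧
      V₀ = r • (A' * B * C') ∧ V₁ = s • (A' * X * B * Y * C') := by
  obtain ⟨w, hw⟩ := hu₀.exists_right_inv
  have hwu : IsUnit w := IsUnit.of_mul_eq_one u₀ (mul_eq_one_comm.1 hw)
  have hYu : IsUnit Y := IsUnit.of_mul_eq_one Y hY
  have e : ∀ a j : Fin 2, _ := fun a j =>
    qblock_sandwich (u₂ := u₂) (u₁ := u₁) (A := A) (X := X) (B := B) (Y := Y) (C := C) hw a j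
  have e0 : ∀ j, w 0 j • V₀ = _ := fun j => by simpa [h₀₀, h₀₁] using e 0 j
  have e1 : ∀ j, w 1 j • V₁ = _ := fun j => by simpa [h₁₁, h₁₀] using e 1 j
  have hprod : ∀ j, w 0 j * w 1 j = 0 := fun j => by
    exact h.mul_eq_zero hV₀ hA hX htr (e0 j) (e1 j)
  -- The outer factors are invertible and `1`, `X` are linearly independent.
  have hzero : ∀ {α β : ℂ} {j : Fin 2},
      (0 : Matrix ι ι ℂ) = A * (α • (1 : Matrix ι ι ℂ) + β • X) * (B * Y ^ (j : ℕ) * C) →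
      α = 0 ∧ β = 0 := by
    intro α β j h0
    have hG : IsUnit (B * Y ^ (j : ℕ) * C) := (hB.mul (hYu.pow _)).mul hC
    have h1 := hG.mul_left_eq_zero.1 h0.symm
    exact coeffs_eq_zero hX htr (hA.mul_right_eq_zero.1 h1)
  have hXX : ∀ M : Matrix ι ι ℂ, X * (X * M) = M := fun M => by
    rw [← Matrix.mul_assoc, hX, Matrix.one_mul]
  have hYY : ∀ M : Matrix ι ι ℂ, Y * (Y * M) = M := fun M => by
    rw [← Matrix.mul_assoc, hY, Matrix.one_mul]
  rcases fin_two_diag_or_antidiag hwu hprod with ⟨n0, n1, z0, z1⟩ | ⟨z0, z1, n0, n1⟩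
  · have k0 := e0 0
    have k1 := e1 1
    obtain ⟨a1, a2⟩ := hzero (by simpa only [z1, zero_smul] using e1 0)
    obtain ⟨a3, a4⟩ := hzero (by simpa only [z0, zero_smul] using e0 1)
    rcases fin_two_cross hu₂ hu₁ (by decide) a1 a2 a3 a4 with ⟨b1, b2⟩ | ⟨b1, b2⟩
    · obtain ⟨r, hr⟩ := eq_smul_of_snd_eq_zero n0 k0 (by simp [b2])
      obtain ⟨s, hs⟩ := eq_smul_of_fst_eq_zero n1 k1 (by simp [b1])
      exact ⟨A, C, r, s, Or.inl rfl, Or.inl rfl, by rw [hr]; simp [Matrix.mul_assoc],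
        by rw [hs]; simp [Matrix.mul_assoc]⟩
    · obtain ⟨r, hr⟩ := eq_smul_of_fst_eq_zero n0 k0 (by simp [b1])
      obtain ⟨s, hs⟩ := eq_smul_of_snd_eq_zero n1 k1 (by simp [b2])
      exact ⟨A * X, C, r, s, Or.inr rfl, Or.inl rfl, by rw [hr]; simp [Matrix.mul_assoc],
        by rw [hs]; simp [Matrix.mul_assoc, hXX]⟩
  · have k0 := e0 1
    have k1 := e1 0
    obtain ⟨a1, a2⟩ := hzero (by simpa only [z1, zero_smul] using e1 1)
    obtain ⟨a3, a4⟩ := hzero (by simpa only [z0, zero_smul] using e0 0)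
    rcases fin_two_cross hu₂ hu₁ (by decide) a1 a2 a3 a4 with ⟨b1, b2⟩ | ⟨b1, b2⟩
    · obtain ⟨r, hr⟩ := eq_smul_of_snd_eq_zero n0 k0 (by simp [b2])
      obtain ⟨s, hs⟩ := eq_smul_of_fst_eq_zero n1 k1 (by simp [b1])
      exact ⟨A, Y * C, r, s, Or.inl rfl, Or.inr rfl, by rw [hr]; simp [Matrix.mul_assoc],
        by rw [hs]; simp [Matrix.mul_assoc, hYY]⟩
    · obtain ⟨r, hr⟩ := eq_smul_of_fst_eq_zero n0 k0 (by simp [b1])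
      obtain ⟨s, hs⟩ := eq_smul_of_snd_eq_zero n1 k1 (by simp [b2])
      exact ⟨A * X, Y * C, r, s, Or.inr rfl, Or.inr rfl, by rw [hr]; simp [Matrix.mul_assoc],
        by rw [hs]; simp [Matrix.mul_assoc, hXX, hYY]⟩

end BlockDiagonal

/-! ### Two couplings do not give a multiplexed bit flip -/

section Multiplexed

/-- The blocks, with respect to a qubit, of an operator that applies to this qubit the identity,
a bit flip, or a bit flip with signs, according to two further bits. -/
structure IsFlipMultiplexer (ε : ℂ) (U : Matrix (Fin 2 × Fin 2 × Fin 2) (Fin 2 × Fin 2 × Fin 2) ℂ) :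
    Prop where
  block₀₀ : qblock 0 0 U = diagonal fun p => if p.1 = 0 then 1 else 0
  block₁₁ : qblock 1 1 U = diagonal fun p => if p.1 = 0 then 1 else 0
  block₀₁ : qblock 0 1 U = diagonal fun p => if p.1 = 0 then 0 else if p.2 = 0 then 1 else ε
  block₁₀ : qblock 1 0 U = diagonal fun p => if p.1 = 0 then 0 else if p.2 = 0 then 1 else -ε

/-- The diagonal of a combination of the blocks of such an operator. -/
def flipDiagonal (ε t₀ t₁ v₀ v₁ : ℂ) (p : Fin 2 × Fin 2) : ℂ :=
  if p.1 = 0 then t₀ * v₀ + t₁ * v₁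
  else if p.2 = 0 then t₀ * v₁ + t₁ * v₀ else ε * (t₀ * v₁ - t₁ * v₀)

variable {ε : ℂ} {u₂ u₁ u₀ w t : Matrix (Fin 2) (Fin 2) ℂ}
  {A X B Y C : Matrix (Fin 2 × Fin 2) (Fin 2 × Fin 2) ℂ}

/-- Both sides are the block `(i, j)` of the operator with `u₂` and `u₀` stripped off. It is
diagonal because all four original blocks are. -/
lemma IsFlipMultiplexer.diagonal_eq
    (h : IsFlipMultiplexer ε (sandwich u₂ A X u₁ B Y u₀ C)) (hw : u₀ * w = 1) (ht : t * u₂ = 1)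
    (i j : Fin 2) :
    diagonal (flipDiagonal ε (t i 0) (t i 1) (w 0 j) (w 1 j)) =
      u₁ i j • (A * X ^ (i : ℕ) * (B * Y ^ (j : ℕ) * C)) := by
  have e0 := qblock_sandwich (u₂ := u₂) (u₁ := u₁) (A := A) (X := X) (B := B) (Y := Y) (C := C)
    hw 0 j
  have e1 := qblock_sandwich (u₂ := u₂) (u₁ := u₁) (A := A) (X := X) (B := B) (Y := Y) (C := C)
    hw 1 j
  set G := B * Y ^ (j : ℕ) * C
  rw [h.block₀₀, h.block₀₁] at e0
  rw [h.block₁₀, h.block₁₁] at e1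
  have hl : diagonal (flipDiagonal ε (t i 0) (t i 1) (w 0 j) (w 1 j)) =
      t i 0 • (A * ((u₂ 0 0 * u₁ 0 j) • (1 : Matrix (Fin 2 × Fin 2) (Fin 2 × Fin 2) ℂ) +
          (u₂ 0 1 * u₁ 1 j) • X) * G) +
        t i 1 • (A * ((u₂ 1 0 * u₁ 0 j) • (1 : Matrix (Fin 2 × Fin 2) (Fin 2 × Fin 2) ℂ) +
          (u₂ 1 1 * u₁ 1 j) • X) * G) := by
    rw [← e0, ← e1]
    simp only [← diagonal_smul, diagonal_add]
    congr 1
    ext ⟨a, b⟩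
    fin_cases a <;> fin_cases b <;> (simp [flipDiagonal]; try ring)
  have h0 := congrFun (congrFun ht i) 0
  have h1 := congrFun (congrFun ht i) 1
  rw [Matrix.mul_apply, Fin.sum_univ_two] at h0 h1
  rw [hl]
  have hr : t i 0 • (A * ((u₂ 0 0 * u₁ 0 j) • (1 : Matrix (Fin 2 × Fin 2) (Fin 2 × Fin 2) ℂ) +
          (u₂ 0 1 * u₁ 1 j) • X) * G) +
        t i 1 • (A * ((u₂ 1 0 * u₁ 0 j) • (1 : Matrix (Fin 2 × Fin 2) (Fin 2 × Fin 2) ℂ) +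
          (u₂ 1 1 * u₁ 1 j) • X) * G) =
      ((t i 0 * u₂ 0 0 + t i 1 * u₂ 1 0) * u₁ 0 j) • (A * G) +
        ((t i 0 * u₂ 0 1 + t i 1 * u₂ 1 1) * u₁ 1 j) • (A * X * G) := by
    simp only [Matrix.mul_add, Matrix.add_mul, Matrix.mul_smul, Matrix.smul_mul, Matrix.mul_one]
    module
  rw [hr, h0, h1]
  obtain rfl | rfl : i = 0 ∨ i = 1 := by lia
  · simp
  · simp

/-- If `u₁ i j` vanished, so would all four products of an entry of row `i` of `t` with one of
column `j` of `w`, or else their combinations: `t₀ v₁ = t₁ v₀ = 0` and `t₀ v₀ + t₁ v₁ = 0`. A zero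
row of `t` or a zero column of `w` would follow. -/
lemma IsFlipMultiplexer.ne_zero
    (h : IsFlipMultiplexer ε (sandwich u₂ A X u₁ B Y u₀ C)) (hε : ε ≠ 0)
    (hw : u₀ * w = 1) (ht : t * u₂ = 1) (i j : Fin 2) : u₁ i j ≠ 0 := by
  intro h0
  have e := h.diagonal_eq hw ht i j
  rw [h0, zero_smul, diagonal_eq_zero] at e
  have e1 := congrFun e (0, 0)
  have e2 := congrFun e (1, 0)
  have e3 := congrFun e (1, 1)
  simp only [flipDiagonal, Pi.zero_apply, if_true, one_ne_zero, if_false, mul_eq_zero, hε,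
    false_or] at e1 e2 e3
  have hw' : w.det ≠ 0 := by
    intro h2
    have := congrArg Matrix.det hw
    rw [Matrix.det_mul, h2] at this
    simp at this
  have ht' : t.det ≠ 0 := by
    intro h2
    have := congrArg Matrix.det ht
    rw [Matrix.det_mul, h2] at this
    simp at this
  rw [Matrix.det_fin_two] at hw' ht'
  have f1 : t i 0 * w 1 j = 0 := by linear_combination (e2 + e3) / 2
  have f2 : t i 1 * w 0 j = 0 := by linear_combination (e2 - e3) / 2
  have hti : ¬ (t i 0 = 0 ∧ t i 1 = 0) := by
    rintro ⟨a, b⟩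
    fin_cases i <;> simp_all
  have hwj : ¬ (w 0 j = 0 ∧ w 1 j = 0) := by
    rintro ⟨a, b⟩
    fin_cases j <;> simp_all
  grind

lemma four_signs {a b c : ℂ} (ha : a * a = 1) (hb : b * b = 1) (hc : c * c = 1)
    (h : a + a + (b + c) = 0) : b = c := by
  rcases mul_self_eq_mul_self_iff.1 (hb.trans hc.symm) with h1 | h1
  · exact h1
  · have : a = 0 := by linear_combination h / 2 - h1 / 2
    simp [this] at ha

/-- Dividing the diagonal block in row 1 by that in row 0 shows that `A X A⁻¹` is diagonal up to no
further change of basis. Its entries are four signs with sum zero. -/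
lemma IsFlipMultiplexer.column_mul_eq_zero
    (h : IsFlipMultiplexer ε (sandwich u₂ A X u₁ B Y u₀ C)) (hε : ε ≠ 0)
    (hw : u₀ * w = 1) (ht : t * u₂ = 1) (hA : IsUnit A) (hB : IsUnit B) (hC : IsUnit C)
    (hY : IsUnit Y) (hX : X * X = 1) (htr : X.trace = 0) (j : Fin 2) : w 0 j * w 1 j = 0 := by
  obtain ⟨A', hA'⟩ := hA.exists_left_inv
  have c0 := h.ne_zero hε hw ht 0 j
  have c1 := h.ne_zero hε hw ht 1 j
  have e0 := h.diagonal_eq hw ht 0 j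
  have e1 := h.diagonal_eq hw ht 1 j
  set G := B * Y ^ (j : ℕ) * C
  have hG : IsUnit G := (hB.mul (hY.pow _)).mul hC
  set τ₀ := flipDiagonal ε (t 0 0) (t 0 1) (w 0 j) (w 1 j)
  set τ₁ := flipDiagonal ε (t 1 0) (t 1 1) (w 0 j) (w 1 j)
  simp only [Fin.val_zero, pow_zero, Matrix.mul_one, Fin.val_one, pow_one] at e0 e1
  have hτ : ∀ p, τ₀ p ≠ 0 := by
    have h1 : IsUnit (diagonal τ₀) := by
      rw [e0]
      exact (hA.mul hG).smul (Units.mk0 _ c0)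
    rw [Matrix.isUnit_diagonal, Pi.isUnit_iff] at h1
    exact fun p => (h1 p).ne_zero
  have hK : (A * X * A') * diagonal τ₀ = (u₁ 0 j / u₁ 1 j) • diagonal τ₁ := by
    rw [e0, e1, smul_smul, div_mul_cancel₀ _ c1, Matrix.mul_smul]
    congr 1
    calc A * X * A' * (A * G) = A * X * (A' * A) * G := by simp only [Matrix.mul_assoc]
      _ = _ := by rw [hA', Matrix.mul_one]
  have hKd : A * X * A' = diagonal fun p => u₁ 0 j / u₁ 1 j * τ₁ p / τ₀ p := by
    ext p q
    have := congrFun (congrFun hK p) q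
    rw [Matrix.mul_diagonal] at this
    by_cases hpq : p = q
    · subst hpq
      simp at this ⊢
      rw [eq_div_iff (hτ p), this]
    · simpa [hpq, hτ q] using this
  have hsq := conj_involution hA' hX
  have htr' := (trace_conj hA' X).trans htr
  rw [hKd] at hsq htr'
  rw [diagonal_mul_diagonal, ← diagonal_one, diagonal_eq_diagonal_iff] at hsq
  rw [trace_diagonal, Fintype.sum_prod_type, Fin.sum_univ_two, Fin.sum_univ_two,
    Fin.sum_univ_two] at htr'
  -- Two of the four signs agree, since `flipDiagonal` ignores the second bit when the first is 0.
  -- Hence the other two agree as well.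
  have h01 : τ₀ (0, 1) = τ₀ (0, 0) := rfl
  have h01' : τ₁ (0, 1) = τ₁ (0, 0) := rfl
  rw [h01, h01'] at htr'
  have key := four_signs (hsq (0, 0)) (hsq (1, 0)) (hsq (1, 1)) htr'
  rw [div_eq_div_iff (hτ _) (hτ _)] at key
  have v10 : τ₀ (1, 0) = t 0 0 * w 1 j + t 0 1 * w 0 j := by simp [τ₀, flipDiagonal]
  have v11 : τ₀ (1, 1) = ε * (t 0 0 * w 1 j - t 0 1 * w 0 j) := by simp [τ₀, flipDiagonal]
  have v10' : τ₁ (1, 0) = t 1 0 * w 1 j + t 1 1 * w 0 j := by simp [τ₁, flipDiagonal]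
  have v11' : τ₁ (1, 1) = ε * (t 1 0 * w 1 j - t 1 1 * w 0 j) := by simp [τ₁, flipDiagonal]
  rw [v10, v11, v10', v11'] at key
  have hq : u₁ 0 j / u₁ 1 j ≠ 0 := div_ne_zero c0 c1
  have ht' : t.det ≠ 0 := by
    intro h2
    have := congrArg Matrix.det ht
    rw [Matrix.det_mul, h2] at this
    simp at this
  rw [Matrix.det_fin_two] at ht'
  -- Cross-multiplying the equality of the last two signs leaves twice this product.
  have hz : (u₁ 0 j / u₁ 1 j * ε * (t 0 0 * t 1 1 - t 0 1 * t 1 0)) * (w 0 j * w 1 j) = 0 := by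
    linear_combination key / 2
  exact (mul_eq_zero.1 hz).resolve_left (mul_ne_zero (mul_ne_zero hq hε) ht')

/-- Column 0 of `w` contains a zero and, by transposition, so does row 0 of `t`. The transpose
exchanges the two signed flips, hence the `-ε`. -/
theorem not_isFlipMultiplexer_sandwich (hu₂ : IsUnit u₂) (hu₀ : IsUnit u₀)
    (hA : IsUnit A) (hB : IsUnit B) (hC : IsUnit C)
    (hX : X * X = 1) (htrX : X.trace = 0) (hY : Y * Y = 1) (htrY : Y.trace = 0) (hε : ε ≠ 0)
    (h : IsFlipMultiplexer ε (sandwich u₂ A X u₁ B Y u₀ C))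
    (h' : IsFlipMultiplexer (-ε) (sandwich u₂ A X u₁ B Y u₀ C)ᵀ) : False := by
  obtain ⟨w, hw⟩ := hu₀.exists_right_inv
  obtain ⟨t, ht⟩ := hu₂.exists_left_inv
  have hXu : IsUnit X := IsUnit.of_mul_eq_one X hX
  have hYu : IsUnit Y := IsUnit.of_mul_eq_one Y hY
  have k1 := h.column_mul_eq_zero hε hw ht hA hB hC hYu hX htrX 0
  rw [sandwich_transpose] at h'
  have ht' : u₂ᵀ * tᵀ = 1 := by rw [← Matrix.transpose_mul, ht, Matrix.transpose_one]
  have hw' : wᵀ * u₀ᵀ = 1 := by rw [← Matrix.transpose_mul, hw, Matrix.transpose_one]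
  have k2 := h'.column_mul_eq_zero (neg_ne_zero.2 hε) ht' hw' (by simpa using hC) (by simpa using hB)
    (by simpa using hA) (by simpa using hXu)
    (by rw [← Matrix.transpose_mul, hY, Matrix.transpose_one]) (by simpa using htrY) 0
  simp only [Matrix.transpose_apply] at k2
  have e := h.diagonal_eq hw ht 0 0
  have hu : IsUnit (diagonal (flipDiagonal ε (t 0 0) (t 0 1) (w 0 0) (w 1 0))) := by
    rw [e]
    exact ((hA.mul (hXu.pow _)).mul ((hB.mul (hYu.pow _)).mul hC)).smul
      (Units.mk0 _ (h.ne_zero hε hw ht 0 0))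
  rw [Matrix.isUnit_diagonal, Pi.isUnit_iff] at hu
  have h1 := (hu (0, 0)).ne_zero
  have h2 := (hu (1, 0)).ne_zero
  simp only [flipDiagonal, if_true, one_ne_zero, if_false] at h1 h2
  -- At most one of the four products of these entries survives, but `h1` and `h2` need one each
  -- from disjoint pairs.
  grind

end Multiplexed

/-! ### Pauli operators and local operators on two qubits -/

section TwoQubits

/-- The Pauli matrix `X`. -/
def pauliX : Matrix (Fin 2) (Fin 2) ℂ := !![0, 1; 1, 0]

/-- The Pauli matrix `Z`. -/
def pauliZ : Matrix (Fin 2) (Fin 2) ℂ := !![1, 0; 0, -1]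

/-- `Z` on the first of two qubits. -/
def zFst : Matrix (Fin 2 × Fin 2) (Fin 2 × Fin 2) ℂ := pauliZ ⊗ₖ 1

/-- `Z` on the second of two qubits. -/
def zSnd : Matrix (Fin 2 × Fin 2) (Fin 2 × Fin 2) ℂ := 1 ⊗ₖ pauliZ

/-- The controlled-`Z` on two qubits. -/
def cz₂ : Matrix (Fin 2 × Fin 2) (Fin 2 × Fin 2) ℂ :=
  diagonal fun p => if p.1 = 1 ∧ p.2 = 1 then -1 else 1

/-- The controlled-`X` on two qubits, with the first as its control. -/
def cx₂ : Matrix (Fin 2 × Fin 2) (Fin 2 × Fin 2) ℂ := ctl pauliX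

/-- An invertible operator on each of two qubits. -/
def IsLocal (A : Matrix (Fin 2 × Fin 2) (Fin 2 × Fin 2) ℂ) : Prop :=
  ∃ a b : Matrix (Fin 2) (Fin 2) ℂ, IsUnit a ∧ IsUnit b ∧ A = a ⊗ₖ b

lemma pauliZ_mul_self : pauliZ * pauliZ = 1 := by
  simp [pauliZ, Matrix.one_fin_two]

lemma zFst_mul_self : zFst * zFst = 1 := by
  rw [zFst, ← Matrix.mul_kronecker_mul, pauliZ_mul_self, Matrix.one_mul, Matrix.one_kronecker_one]

lemma zSnd_mul_self : zSnd * zSnd = 1 := by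
  rw [zSnd, ← Matrix.mul_kronecker_mul, pauliZ_mul_self, Matrix.one_mul, Matrix.one_kronecker_one]

lemma trace_pauliZ : pauliZ.trace = 0 := by simp [pauliZ, Matrix.trace_fin_two]

lemma trace_zFst : zFst.trace = 0 := by simp [zFst, Matrix.trace_kronecker, trace_pauliZ]

lemma trace_zSnd : zSnd.trace = 0 := by simp [zSnd, Matrix.trace_kronecker, trace_pauliZ]

lemma det_zFst : zFst.det = 1 := by simp [zFst, Matrix.det_kronecker, pauliZ]

lemma det_zSnd : zSnd.det = 1 := by simp [zSnd, Matrix.det_kronecker, pauliZ]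

lemma cx₂_mul_self : cx₂ * cx₂ = 1 := by
  ext ⟨a, b⟩ ⟨c, d⟩
  fin_cases a <;> fin_cases b <;> fin_cases c <;> fin_cases d <;>
    simp [cx₂, ctl, pauliX, Matrix.mul_apply, Fintype.sum_prod_type, Matrix.one_apply]

lemma cz₂_mul_self : cz₂ * cz₂ = 1 := by
  rw [cz₂, diagonal_mul_diagonal, ← diagonal_one]
  congr 1
  ext p
  split_ifs <;> simp

lemma det_cz₂ : cz₂.det = -1 := by
  simp [cz₂, Matrix.det_diagonal, Fintype.prod_prod_type]

lemma trace_cz₂ : cz₂.trace = 2 := by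
  simp [cz₂, Matrix.trace_diagonal, Fintype.sum_prod_type]
  norm_num

lemma IsLocal.isUnit {A : Matrix (Fin 2 × Fin 2) (Fin 2 × Fin 2) ℂ} (h : IsLocal A) : IsUnit A := by
  obtain ⟨a, b, ha, hb, rfl⟩ := h
  rw [Matrix.isUnit_iff_isUnit_det] at *
  rw [Matrix.det_kronecker]
  exact (ha.pow _).mul (hb.pow _)

lemma IsLocal.mul {A B : Matrix (Fin 2 × Fin 2) (Fin 2 × Fin 2) ℂ} (hA : IsLocal A)
    (hB : IsLocal B) : IsLocal (A * B) := by
  obtain ⟨a, b, ha, hb, rfl⟩ := hA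
  obtain ⟨c, d, hc, hd, rfl⟩ := hB
  exact ⟨a * c, b * d, ha.mul hc, hb.mul hd, by rw [Matrix.mul_kronecker_mul]⟩

lemma isUnit_pauliZ : IsUnit pauliZ := IsUnit.of_mul_eq_one _ pauliZ_mul_self

lemma isLocal_zFst : IsLocal zFst := ⟨pauliZ, 1, isUnit_pauliZ, isUnit_one, rfl⟩

lemma isLocal_zSnd : IsLocal zSnd := ⟨1, pauliZ, isUnit_one, isUnit_pauliZ, rfl⟩

lemma isLocal_one : IsLocal 1 := ⟨1, 1, isUnit_one, isUnit_one, Matrix.one_kronecker_one.symm⟩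

lemma IsLocal.conj_zFst {A A' : Matrix (Fin 2 × Fin 2) (Fin 2 × Fin 2) ℂ} (h : IsLocal A)
    (hA : A' * A = 1) : ∃ a : Matrix (Fin 2) (Fin 2) ℂ, a * a = 1 ∧ A * zFst * A' = a ⊗ₖ 1 := by
  obtain ⟨a, b, ha, hb, rfl⟩ := h
  obtain ⟨a', ha'⟩ := ha.exists_left_inv
  obtain ⟨b', hb'⟩ := hb.exists_left_inv
  have : A' = a' ⊗ₖ b' := by
    refine left_inv_eq_right_inv hA ?_
    rw [← Matrix.mul_kronecker_mul, mul_eq_one_comm.1 ha', mul_eq_one_comm.1 hb',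
      Matrix.one_kronecker_one]
  refine ⟨a * pauliZ * a', conj_involution ha' pauliZ_mul_self, ?_⟩
  rw [this, zFst, ← Matrix.mul_kronecker_mul, ← Matrix.mul_kronecker_mul, Matrix.mul_one,
    mul_eq_one_comm.1 hb']

lemma IsLocal.conj_zSnd {A A' : Matrix (Fin 2 × Fin 2) (Fin 2 × Fin 2) ℂ} (h : IsLocal A)
    (hA : A' * A = 1) : ∃ a : Matrix (Fin 2) (Fin 2) ℂ, a * a = 1 ∧ A * zSnd * A' = 1 ⊗ₖ a := by
  obtain ⟨a, b, ha, hb, rfl⟩ := h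
  obtain ⟨a', ha'⟩ := ha.exists_left_inv
  obtain ⟨b', hb'⟩ := hb.exists_left_inv
  have : A' = a' ⊗ₖ b' := by
    refine left_inv_eq_right_inv hA ?_
    rw [← Matrix.mul_kronecker_mul, mul_eq_one_comm.1 ha', mul_eq_one_comm.1 hb',
      Matrix.one_kronecker_one]
  refine ⟨b * pauliZ * b', conj_involution hb' pauliZ_mul_self, ?_⟩
  rw [this, zSnd, ← Matrix.mul_kronecker_mul, ← Matrix.mul_kronecker_mul, Matrix.mul_one,
    mul_eq_one_comm.1 ha']

lemma IsLocal.left_inv {A A' : Matrix (Fin 2 × Fin 2) (Fin 2 × Fin 2) ℂ} (h : IsLocal A)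
    (hA : A' * A = 1) : IsLocal A' := by
  obtain ⟨a, b, ha, hb, rfl⟩ := h
  obtain ⟨a', ha'⟩ := ha.exists_left_inv
  obtain ⟨b', hb'⟩ := hb.exists_left_inv
  refine ⟨a', b', IsUnit.of_mul_eq_one _ ha', IsUnit.of_mul_eq_one _ hb', ?_⟩
  refine left_inv_eq_right_inv hA ?_
  rw [← Matrix.mul_kronecker_mul, mul_eq_one_comm.1 ha', mul_eq_one_comm.1 hb',
    Matrix.one_kronecker_one]

end TwoQubits

/-! ### Obstruction seen from the qubit `n` -/

section Target

/-- A conjugate of `cz₂` is an involution of trace 2. Within the span, the trace gives `α = 1/2`,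
whereas squaring to 1 gives `αβ = 0` and `α² + β² = 1`. -/
theorem avoidsInvolutionSpan_cx_cz : AvoidsInvolutionSpan cx₂ (cx₂ * cz₂) := by
  intro K α β hK htr h
  have h1 : cx₂ * cz₂ * cx₂ = α • 1 + β • K := by
    rw [h, Matrix.mul_assoc, cx₂_mul_self, Matrix.mul_one]
  have h2 : 2 = α * 4 := by
    have := congrArg Matrix.trace h1
    rw [trace_conj cx₂_mul_self, trace_cz₂] at this
    simpa [htr] using this
  have h3 := conj_involution cx₂_mul_self cz₂_mul_self
  rw [h1] at h3
  have h4 : (2 * α * β) • K = (1 - α ^ 2 - β ^ 2) • (1 : Matrix (Fin 2 × Fin 2) (Fin 2 × Fin 2) ℂ) := by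
    have : (α • 1 + β • K) * (α • 1 + β • K) =
        (α ^ 2 + β ^ 2) • (1 : Matrix (Fin 2 × Fin 2) (Fin 2 × Fin 2) ℂ) + (2 * α * β) • K := by
      simp only [Matrix.add_mul, Matrix.mul_add, Matrix.smul_mul, Matrix.mul_smul, Matrix.one_mul,
        Matrix.mul_one, hK]
      module
    rw [this] at h3
    calc (2 * α * β) • K = (α ^ 2 + β ^ 2) • (1 : Matrix (Fin 2 × Fin 2) (Fin 2 × Fin 2) ℂ) +
          (2 * α * β) • K - (α ^ 2 + β ^ 2) • (1 : Matrix (Fin 2 × Fin 2) (Fin 2 × Fin 2) ℂ) := by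
          module
      _ = _ := by rw [h3]; module
  have h5 := coeffs_eq_zero (α := 1 - α ^ 2 - β ^ 2) (β := -(2 * α * β)) hK htr (by
    rw [← h4]; module)
  have hα : α = 1 / 2 := by linear_combination -h2 / 4
  obtain ⟨h6, h7⟩ := h5
  subst hα
  have hβ : β = 0 := by linear_combination -h7
  norm_num [hβ] at h6

/-- The normal form makes a conjugate `W` of `cz₂` equal to `c R₁ R₂`, with involutions `R₁`, `R₂`
of determinant 1. The nonzero trace of `W` forces `c² = 1`, but its determinant -1 forces `c⁴ = -1`.
-/
theorem not_sandwich_cx_cz {u₂ u₁ u₀ : Matrix (Fin 2) (Fin 2) ℂ}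
    {A X B Y C : Matrix (Fin 2 × Fin 2) (Fin 2 × Fin 2) ℂ}
    (h₀₀ : qblock 0 0 (sandwich u₂ A X u₁ B Y u₀ C) = cx₂)
    (h₁₁ : qblock 1 1 (sandwich u₂ A X u₁ B Y u₀ C) = cx₂ * cz₂)
    (h₀₁ : qblock 0 1 (sandwich u₂ A X u₁ B Y u₀ C) = 0)
    (h₁₀ : qblock 1 0 (sandwich u₂ A X u₁ B Y u₀ C) = 0)
    (hu₂ : IsUnit u₂) (hu₁ : IsUnit u₁) (hu₀ : IsUnit u₀) (hA : IsUnit A) (hB : IsUnit B)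
    (hC : IsUnit C) (hX : X * X = 1) (htr : X.trace = 0) (hdX : X.det = 1)
    (hY : Y * Y = 1) (hdY : Y.det = 1) : False := by
  obtain ⟨A', C', r, s, hA', hC', e0, e1⟩ := avoidsInvolutionSpan_cx_cz.sandwich_form
    (IsUnit.of_mul_eq_one _ cx₂_mul_self) h₀₀ h₁₁ h₀₁ h₁₀ hu₂ hu₁ hu₀ hA hB hC hX htr hY
  have hA'u : IsUnit A' := by
    rcases hA' with rfl | rfl
    exacts [hA, hA.mul (IsUnit.of_mul_eq_one _ hX)]
  obtain ⟨D, hD⟩ := hA'u.exists_left_inv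
  obtain ⟨E, hE⟩ := hB.exists_left_inv
  have hr : r ≠ 0 := by
    rintro rfl
    have := cx₂_mul_self
    rw [e0] at this
    simp at this
  set R₁ := A' * X * D
  set R₂ := A' * (B * Y * E) * D
  have hR₁ : R₁ * R₁ = 1 := conj_involution hD hX
  have hR₂ : R₂ * R₂ = 1 := conj_involution hD (conj_involution hE hY)
  have hdet : ∀ {P Q S : Matrix (Fin 2 × Fin 2) (Fin 2 × Fin 2) ℂ}, Q * P = 1 →
      (P * S * Q).det = S.det := by
    intro P Q S h
    rw [Matrix.det_mul, Matrix.det_mul, mul_right_comm, ← Matrix.det_mul, mul_eq_one_comm.1 h,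
      Matrix.det_one, one_mul]
  have hd₁ : R₁.det = 1 := (hdet hD).trans hdX
  have hd₂ : R₂.det = 1 := (hdet hD).trans ((hdet hE).trans hdY)
  have hW : cx₂ * cz₂ * cx₂ = (s / r) • (R₁ * R₂) := by
    have h1 : cx₂ * cz₂ = (s / r) • (R₁ * R₂) * cx₂ := by
      rw [e1, e0, Matrix.mul_smul, Matrix.smul_mul, smul_smul, mul_div_cancel₀ _ hr]
      congr 1
      calc A' * X * B * Y * C' = A' * X * (B * Y * C') := by simp only [Matrix.mul_assoc]
        _ = A' * X * (D * A') * (B * Y * (E * (D * A') * B) * C') := by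
          rw [hD, Matrix.mul_one, Matrix.mul_one, hE, Matrix.mul_one]
        _ = R₁ * R₂ * (A' * B * C') := by simp only [R₁, R₂, Matrix.mul_assoc]
    rw [h1, Matrix.mul_assoc, cx₂_mul_self, Matrix.mul_one]
  have hW2 := conj_involution cx₂_mul_self cz₂_mul_self
  have hWt := (trace_conj cx₂_mul_self cz₂).trans trace_cz₂
  have hWd := (hdet (S := cz₂) cx₂_mul_self).trans det_cz₂
  set W := cx₂ * cz₂ * cx₂
  set c := s / r
  clear_value W c R₁ R₂
  have h21 : R₂ * R₁ = c • W := by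
    calc R₂ * R₁ = R₂ * R₁ * (c • (R₁ * R₂) * W) := by rw [← hW, hW2, Matrix.mul_one]
      _ = c • (R₂ * (R₁ * R₁) * R₂ * W) := by
        simp only [Matrix.smul_mul, Matrix.mul_smul, Matrix.mul_assoc]
      _ = c • W := by rw [hR₁, Matrix.mul_one, hR₂, Matrix.one_mul]
  -- Conjugation by `R₁` multiplies `W` by `c²` and preserves its trace, which is 2.
  have hc : c * c = 1 := by
    have h1 : R₁ * W * R₁ = (c * c) • W := by
      calc R₁ * W * R₁ = R₁ * (c • (R₁ * R₂)) * R₁ := by rw [← hW]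
        _ = c • (R₁ * R₁ * (R₂ * R₁)) := by
          simp only [Matrix.mul_smul, Matrix.smul_mul, Matrix.mul_assoc]
        _ = (c * c) • W := by rw [hR₁, Matrix.one_mul, h21, smul_smul]
    have h2 := congrArg Matrix.trace h1
    rw [trace_conj hR₁, Matrix.trace_smul, hWt, smul_eq_mul] at h2
    linear_combination -h2 / 2
  rw [hW, Matrix.det_smul, Matrix.det_mul, hd₁, hd₂] at hWd
  have h4 : c ^ 4 = -1 := by simpa using hWd
  have : (c * c) * (c * c) = -1 := by rw [← h4]; ring
  rw [hc] at this
  norm_num at this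

end Target

/-! ### Obstruction seen from the qubit `l` -/

section Control

/-- The operator on the target and the last qubit that is controlled in the Peres operator. -/
def xcz₂ : Matrix (Fin 2 × Fin 2) (Fin 2 × Fin 2) ℂ := (pauliX ⊗ₖ 1) * cz₂

lemma xcz₂_apply (p q : Fin 2 × Fin 2) :
    xcz₂ p q = if p.1 ≠ q.1 ∧ p.2 = q.2 then (if q.1 = 1 ∧ q.2 = 1 then -1 else 1) else 0 := by
  obtain ⟨a, b⟩ := p
  obtain ⟨c, d⟩ := q
  fin_cases a <;> fin_cases b <;> fin_cases c <;> fin_cases d <;>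
    simp [xcz₂, cz₂, pauliX, Matrix.mul_diagonal, Matrix.kroneckerMap_apply]

lemma xcz₂_mul_self : xcz₂ * xcz₂ = zSnd := by
  ext ⟨a, b⟩ ⟨c, d⟩
  fin_cases a <;> fin_cases b <;> fin_cases c <;> fin_cases d <;>
    simp [Matrix.mul_apply, xcz₂_apply, Fintype.sum_prod_type, zSnd, pauliZ]

lemma trace_xcz₂ : xcz₂.trace = 0 := by simp [Matrix.trace, xcz₂_apply]

lemma zSnd_ne_smul_one (c : ℂ) : zSnd ≠ c • 1 := by
  intro h
  have h0 := congrFun (congrFun h (0, 0)) (0, 0)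
  have h1 := congrFun (congrFun h (0, 1)) (0, 1)
  simp [zSnd, pauliZ] at h0 h1
  rw [← h0] at h1
  norm_num at h1

/-- The trace gives `α = 0`, and then the square would be scalar; but `xcz₂` squares to `zSnd`. -/
theorem avoidsInvolutionSpan_one_xcz : AvoidsInvolutionSpan 1 xcz₂ := by
  intro K α β hK htr h
  rw [Matrix.mul_one] at h
  have h0 : α = 0 := by
    have := congrArg Matrix.trace h
    simpa [trace_xcz₂, htr] using this.symm
  subst h0
  refine zSnd_ne_smul_one (β * β) ?_
  rw [← xcz₂_mul_self, h]
  simp [hK, smul_smul]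

lemma xcz₂_mul_fst {a : Matrix (Fin 2) (Fin 2) ℂ} {c : ℂ} (hc : c ≠ 0)
    (htr : (xcz₂ * (a ⊗ₖ 1)).trace = 0)
    (h : xcz₂ * (a ⊗ₖ 1) * (xcz₂ * (a ⊗ₖ 1)) = c • 1) : False := by
  have e : ∀ p q : Fin 2 × Fin 2, _ := fun p q => congrFun (congrFun h p) q
  have e1 := e (0, 0) (0, 0)
  have e2 := e (1, 0) (1, 0)
  have e3 := e (0, 1) (0, 1)
  simp [Matrix.trace, Matrix.mul_apply, xcz₂_apply, Fintype.sum_prod_type, Matrix.one_apply] at htr e1 e2 e3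
  rw [htr] at e2
  exact hc (by linear_combination (e1 - e3) / 2 - e2)

/-- As `a² = 1`, two diagonal entries of the square are those of `Z`, which differ in sign. -/
lemma xcz₂_mul_snd {a : Matrix (Fin 2) (Fin 2) ℂ} {c : ℂ} (ha : a * a = 1)
    (h : xcz₂ * (1 ⊗ₖ a) * (xcz₂ * (1 ⊗ₖ a)) = c • 1) : False := by
  have e : ∀ p q : Fin 2 × Fin 2, _ := fun p q => congrFun (congrFun h p) q
  have e1 := e (0, 0) (0, 0)
  have e3 := e (0, 1) (0, 1)
  have h0 := congrFun (congrFun ha 0) 0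
  have h1 := congrFun (congrFun ha 1) 1
  simp [Matrix.mul_apply, xcz₂_apply, Fintype.sum_prod_type, Matrix.one_apply] at e1 e3 h0 h1
  have h2 : c = 1 := e1.symm.trans h0
  have h3 : c = -1 := by linear_combination -h1 - e3
  norm_num [h2] at h3

/-- Multiplying `xcz₂` by the one-qubit factor would leave a multiple of a traceless involution, up
to conjugation; the two preceding lemmas exclude this. -/
lemma xcz₂_ne_mul_involution {S N : Matrix (Fin 2 × Fin 2) (Fin 2 × Fin 2) ℂ} {c : ℂ}
    (hS : S * S = 1) (htrS : S.trace = 0) (hN : N * N = 1) (htrN : N.trace = 0)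
    (hloc : (∃ a : Matrix (Fin 2) (Fin 2) ℂ, a * a = 1 ∧ (S = a ⊗ₖ 1 ∨ S = 1 ⊗ₖ a)) ∨
      ∃ a : Matrix (Fin 2) (Fin 2) ℂ, a * a = 1 ∧ (N = a ⊗ₖ 1 ∨ N = 1 ⊗ₖ a)) :
    xcz₂ ≠ c • (S * N) := by
  intro h
  have hc : c * c ≠ 0 := by
    intro hc
    rw [mul_self_eq_zero.1 hc, zero_smul] at h
    have := congrFun (congrFun h (0, 0)) (1, 0)
    simp [xcz₂_apply] at this
  have key : ∃ M : Matrix (Fin 2 × Fin 2) (Fin 2 × Fin 2) ℂ,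
      (∃ a : Matrix (Fin 2) (Fin 2) ℂ, a * a = 1 ∧ (M = a ⊗ₖ 1 ∨ M = 1 ⊗ₖ a)) ∧
      (xcz₂ * M).trace = 0 ∧ xcz₂ * M * (xcz₂ * M) = (c * c) • 1 := by
    rcases hloc with hloc | hloc
    · refine ⟨S, hloc, ?_, ?_⟩
      · rw [Matrix.trace_mul_comm, h, Matrix.mul_smul, ← Matrix.mul_assoc, hS, Matrix.one_mul,
          Matrix.trace_smul, htrN, smul_zero]
      · calc xcz₂ * S * (xcz₂ * S) = c • (S * N) * S * (c • (S * N) * S) := by rw [h]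
          _ = (c * c) • (S * N * (S * S) * N * S) := by
            simp only [Matrix.mul_smul, Matrix.smul_mul, Matrix.mul_assoc, smul_smul]
          _ = (c * c) • (S * (N * N) * S) := by
            rw [hS, Matrix.mul_one]; simp only [Matrix.mul_assoc]
          _ = (c * c) • 1 := by rw [hN, Matrix.mul_one, hS]
    · have h1 : xcz₂ * N = c • S := by
        rw [h, Matrix.smul_mul, Matrix.mul_assoc, hN, Matrix.mul_one]
      refine ⟨N, hloc, ?_, ?_⟩
      · rw [h1, Matrix.trace_smul, htrS, smul_zero]
      · rw [h1, Matrix.smul_mul, Matrix.mul_smul, hS, smul_smul]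
  obtain ⟨M, ⟨a, ha, rfl | rfl⟩, h1, h2⟩ := key
  · exact xcz₂_mul_fst hc h1 h2
  · exact xcz₂_mul_snd ha h2

lemma IsLocal.conj_z {A A' X : Matrix (Fin 2 × Fin 2) (Fin 2 × Fin 2) ℂ} (h : IsLocal A)
    (hA : A' * A = 1) (hX : X = zFst ∨ X = zSnd) :
    ∃ a : Matrix (Fin 2) (Fin 2) ℂ, a * a = 1 ∧ (A * X * A' = a ⊗ₖ 1 ∨ A * X * A' = 1 ⊗ₖ a) := by
  rcases hX with rfl | rfl
  · obtain ⟨a, ha, e⟩ := h.conj_zFst hA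
    exact ⟨a, ha, Or.inl e⟩
  · obtain ⟨a, ha, e⟩ := h.conj_zSnd hA
    exact ⟨a, ha, Or.inr e⟩

/-- Eliminating `B` gives `xcz₂` as a multiple of `(A X A⁻¹) (C⁻¹ Y C)`. If `A` or `C` is local, one
factor acts on a single qubit. If `B` is local, `X` and `B Y B⁻¹` act on different qubits and
commute, so the square of `xcz₂` would be scalar. -/
theorem xcz₂_form_not_local {A B C X Y : Matrix (Fin 2 × Fin 2) (Fin 2 × Fin 2) ℂ} {r s : ℂ}
    (hXY : X = zFst ∧ Y = zSnd ∨ X = zSnd ∧ Y = zFst)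
    (hA : IsUnit A) (hB : IsUnit B) (hC : IsUnit C)
    (h₀ : 1 = r • (A * B * C)) (h₁ : xcz₂ = s • (A * X * B * Y * C)) :
    ¬ IsLocal A ∧ ¬ IsLocal B ∧ ¬ IsLocal C := by
  have hXz : X = zFst ∨ X = zSnd := by tauto
  have hYz : Y = zFst ∨ Y = zSnd := by tauto
  have hX : X * X = 1 := by
    rcases hXz with rfl | rfl
    exacts [zFst_mul_self, zSnd_mul_self]
  have hY : Y * Y = 1 := by
    rcases hYz with rfl | rfl
    exacts [zFst_mul_self, zSnd_mul_self]
  have htX : X.trace = 0 := by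
    rcases hXz with rfl | rfl
    exacts [trace_zFst, trace_zSnd]
  have htY : Y.trace = 0 := by
    rcases hYz with rfl | rfl
    exacts [trace_zFst, trace_zSnd]
  obtain ⟨A', hA'⟩ := hA.exists_left_inv
  obtain ⟨B', hB'⟩ := hB.exists_left_inv
  obtain ⟨C', hC'⟩ := hC.exists_left_inv
  have hC'' := mul_eq_one_comm.1 hC'
  have hA'' := mul_eq_one_comm.1 hA'
  have hBC : ∃ c : ℂ, B = c • (A' * C') := by
    have hr : r ≠ 0 := by
      rintro rfl
      simp at h₀
    refine ⟨r⁻¹, ?_⟩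
    calc B = r⁻¹ • (A' * (r • (A * B * C)) * C') := by
          simp only [Matrix.mul_smul, Matrix.smul_mul, inv_smul_smul₀ hr]
          calc B = (A' * A) * B * (C * C') := by rw [hA', hC'', Matrix.one_mul, Matrix.mul_one]
            _ = _ := by simp only [Matrix.mul_assoc]
      _ = r⁻¹ • (A' * C') := by rw [← h₀, Matrix.mul_one]
  obtain ⟨c, hc⟩ := hBC
  have hV : xcz₂ = (s * c) • (A * X * A' * (C' * Y * C)) := by
    rw [h₁, hc, ← smul_smul]
    simp only [Matrix.mul_smul, Matrix.smul_mul, Matrix.mul_assoc]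
  have hS := conj_involution hA' hX
  have hN := conj_involution hC'' hY
  have htS := (trace_conj hA' X).trans htX
  have htN := (trace_conj hC'' Y).trans htY
  refine ⟨fun hl => ?_, fun hl => ?_, fun hl => ?_⟩
  · exact xcz₂_ne_mul_involution hS htS hN htN (Or.inl (hl.conj_z hA' hXz)) hV
  · have hcomm : X * (B * Y * B') = B * Y * B' * X := by
      rcases hXY with ⟨rfl, rfl⟩ | ⟨rfl, rfl⟩
      · obtain ⟨a, -, e⟩ := hl.conj_zSnd hB'
        rw [e, zFst, ← Matrix.mul_kronecker_mul, ← Matrix.mul_kronecker_mul]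
        simp
      · obtain ⟨a, -, e⟩ := hl.conj_zFst hB'
        rw [e, zSnd, ← Matrix.mul_kronecker_mul, ← Matrix.mul_kronecker_mul]
        simp
    have hM := conj_involution hB' hY
    have hsq : (X * (B * Y * B')) * (X * (B * Y * B')) = 1 := by
      calc (X * (B * Y * B')) * (X * (B * Y * B')) = (X * (B * Y * B')) * (B * Y * B' * X) := by
            rw [hcomm]
        _ = X * ((B * Y * B') * (B * Y * B')) * X := by simp only [Matrix.mul_assoc]
        _ = 1 := by rw [hM, Matrix.mul_one, hX]
    have hV' : ∃ d : ℂ, xcz₂ = d • (A * (X * (B * Y * B')) * A') := by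
      have hBC' : ∃ d : ℂ, C = d • (B' * A') := by
        refine ⟨r⁻¹, ?_⟩
        have hr : r ≠ 0 := by
          rintro rfl
          simp at h₀
        calc C = r⁻¹ • (B' * A' * (r • (A * B * C))) := by
              simp only [Matrix.mul_smul, inv_smul_smul₀ hr]
              calc C = B' * (A' * A) * B * C := by
                    rw [hA', Matrix.mul_one, hB', Matrix.one_mul]
                _ = _ := by simp only [Matrix.mul_assoc]
          _ = r⁻¹ • (B' * A') := by rw [← h₀, Matrix.mul_one]
      obtain ⟨d, hd⟩ := hBC'
      refine ⟨s * d, ?_⟩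
      rw [h₁, ← smul_smul]
      conv_lhs => rw [hd]
      simp only [Matrix.mul_smul, Matrix.mul_assoc]
    obtain ⟨d, hd⟩ := hV'
    refine zSnd_ne_smul_one (d * d) ?_
    rw [← xcz₂_mul_self, hd, Matrix.smul_mul, Matrix.mul_smul, conj_involution hA' hsq, smul_smul]
  · exact xcz₂_ne_mul_involution hS htS hN htN (Or.inr ((hl.left_inv hC').conj_z hC'' hYz)) hV

end Control

/-! ### Counting couplings to a distinguished qubit -/

section Layers

/-- A two-qubit operator that is invertible, and local if no two-qubit gate is used. -/
def IsTwoQubit (k : ℕ) (A : Matrix (Fin 2 × Fin 2) (Fin 2 × Fin 2) ℂ) : Prop :=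
  IsUnit A ∧ (k = 0 → IsLocal A)

lemma IsLocal.isTwoQubit {A : Matrix (Fin 2 × Fin 2) (Fin 2 × Fin 2) ℂ} (h : IsLocal A) (k : ℕ) :
    IsTwoQubit k A := ⟨h.isUnit, fun _ => h⟩

lemma IsTwoQubit.mul {A B : Matrix (Fin 2 × Fin 2) (Fin 2 × Fin 2) ℂ} {k k' : ℕ}
    (hA : IsTwoQubit k A) (hB : IsTwoQubit k' B) : IsTwoQubit (k + k') (A * B) :=
  ⟨hA.1.mul hB.1, fun h => (hA.2 (by lia)).mul (hB.2 (by lia))⟩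

lemma isTwoQubit_cz₂ : IsTwoQubit 1 cz₂ :=
  ⟨IsUnit.of_mul_eq_one _ cz₂_mul_self, fun h => absurd h one_ne_zero⟩

/-- Operators on a distinguished qubit and two further ones, built from operators that do not
couple the distinguished qubit to the others (with `k` two-qubit gates among the latter), `a`
controlled-`Z` on the distinguished qubit and the first of the others, and `b` controlled-`Z` on the
distinguished qubit and the second. -/
inductive Layered :
    ℕ → ℕ → ℕ → Matrix (Fin 2 × Fin 2 × Fin 2) (Fin 2 × Fin 2 × Fin 2) ℂ → Prop
  | base {k : ℕ} {u : Matrix (Fin 2) (Fin 2) ℂ} {A : Matrix (Fin 2 × Fin 2) (Fin 2 × Fin 2) ℂ}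
      (hu : IsUnit u) (hA : IsTwoQubit k A) : Layered 0 0 k (u ⊗ₖ A)
  | fst {a b k k' : ℕ} {u : Matrix (Fin 2) (Fin 2) ℂ}
      {A : Matrix (Fin 2 × Fin 2) (Fin 2 × Fin 2) ℂ}
      {U : Matrix (Fin 2 × Fin 2 × Fin 2) (Fin 2 × Fin 2 × Fin 2) ℂ}
      (hu : IsUnit u) (hA : IsTwoQubit k A) (hU : Layered a b k' U) :
      Layered (a + 1) b (k + k') ((u ⊗ₖ A) * (ctl zFst * U))
  | snd {a b k k' : ℕ} {u : Matrix (Fin 2) (Fin 2) ℂ}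
      {A : Matrix (Fin 2 × Fin 2) (Fin 2 × Fin 2) ℂ}
      {U : Matrix (Fin 2 × Fin 2 × Fin 2) (Fin 2 × Fin 2 × Fin 2) ℂ}
      (hu : IsUnit u) (hA : IsTwoQubit k A) (hU : Layered a b k' U) :
      Layered a (b + 1) (k + k') ((u ⊗ₖ A) * (ctl zSnd * U))

variable {a b k : ℕ} {U : Matrix (Fin 2 × Fin 2 × Fin 2) (Fin 2 × Fin 2 × Fin 2) ℂ}

lemma Layered.left_mul {k' : ℕ} {u : Matrix (Fin 2) (Fin 2) ℂ}
    {A : Matrix (Fin 2 × Fin 2) (Fin 2 × Fin 2) ℂ} (hU : Layered a b k U) (hu : IsUnit u)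
    (hA : IsTwoQubit k' A) : Layered a b (k' + k) ((u ⊗ₖ A) * U) := by
  cases hU with
  | base hv hB =>
    rw [← Matrix.mul_kronecker_mul]
    exact .base (hu.mul hv) (hA.mul hB)
  | fst hv hB hU =>
    rw [← Matrix.mul_assoc, ← Matrix.mul_kronecker_mul, ← add_assoc]
    exact .fst (hu.mul hv) (hA.mul hB) hU
  | snd hv hB hU =>
    rw [← Matrix.mul_assoc, ← Matrix.mul_kronecker_mul, ← add_assoc]
    exact .snd (hu.mul hv) (hA.mul hB) hU

lemma Layered.ctl_zFst_mul (hU : Layered a b k U) : Layered (a + 1) b k (ctl zFst * U) := by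
  have := Layered.fst isUnit_one (isLocal_one.isTwoQubit 0) hU
  simpa using this

lemma Layered.ctl_zSnd_mul (hU : Layered a b k U) : Layered a (b + 1) k (ctl zSnd * U) := by
  have := Layered.snd isUnit_one (isLocal_one.isTwoQubit 0) hU
  simpa using this

lemma ctl_one : ctl (1 : Matrix (Fin 2 × Fin 2) (Fin 2 × Fin 2) ℂ) = 1 := by
  ext ⟨a, i⟩ ⟨b, j⟩
  by_cases h : a = b <;> simp [ctl, h, Matrix.one_apply]

lemma ctl_mul_ctl (X Y : Matrix (Fin 2 × Fin 2) (Fin 2 × Fin 2) ℂ) (h : X * Y = 1) :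
    ctl X * ctl Y = 1 := by
  rw [← ctl_one]
  ext ⟨a, i⟩ ⟨b, j⟩
  have : ∀ V W : Matrix (Fin 2 × Fin 2 × Fin 2) (Fin 2 × Fin 2 × Fin 2) ℂ,
      qblock a b V = qblock a b W → V (a, i) (b, j) = W (a, i) (b, j) :=
    fun V W h => congrFun (congrFun h i) j
  apply this
  rw [qblock_mul, Fin.sum_univ_two]
  fin_cases a <;> fin_cases b <;> simp [qblock_ctl, h]

lemma Layered.exists_of_zero (h : Layered 0 0 k U) :
    ∃ (u : Matrix (Fin 2) (Fin 2) ℂ) (A : Matrix (Fin 2 × Fin 2) (Fin 2 × Fin 2) ℂ),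
      IsUnit u ∧ IsTwoQubit k A ∧ U = u ⊗ₖ A := by
  cases h with
  | base hu hA => exact ⟨_, _, hu, hA, rfl⟩

lemma Layered.exists_of_add_eq_succ {d : ℕ} (h : Layered a b k U) (hab : a + b = d + 1) :
    ∃ (u : Matrix (Fin 2) (Fin 2) ℂ) (A X : Matrix (Fin 2 × Fin 2) (Fin 2 × Fin 2) ℂ)
      (V : Matrix (Fin 2 × Fin 2 × Fin 2) (Fin 2 × Fin 2 × Fin 2) ℂ) (a' b' k₁ k₂ : ℕ),
      IsUnit u ∧ IsTwoQubit k₁ A ∧ Layered a' b' k₂ V ∧ k = k₁ + k₂ ∧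
      (X = zFst ∧ a = a' + 1 ∧ b = b' ∨ X = zSnd ∧ a = a' ∧ b = b' + 1) ∧
      U = (u ⊗ₖ A) * (ctl X * V) := by
  cases h with
  | base hu hA => simp at hab
  | fst hu hA hU => exact ⟨_, _, _, _, _, _, _, _, hu, hA, hU, rfl, Or.inl ⟨rfl, rfl, rfl⟩, rfl⟩
  | snd hu hA hU => exact ⟨_, _, _, _, _, _, _, _, hu, hA, hU, rfl, Or.inr ⟨rfl, rfl, rfl⟩, rfl⟩

lemma Layered.exists_sandwich_of_le_two (h : Layered a b k U) (hab : a + b ≤ 2) :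
    ∃ (u₂ u₁ u₀ : Matrix (Fin 2) (Fin 2) ℂ)
      (A X B Y C : Matrix (Fin 2 × Fin 2) (Fin 2 × Fin 2) ℂ),
      IsUnit u₂ ∧ IsUnit u₁ ∧ IsUnit u₀ ∧ IsUnit A ∧ IsUnit B ∧ IsUnit C ∧
      (X = zFst ∨ X = zSnd) ∧ (Y = zFst ∨ Y = zSnd ∨ (Y = 1 ∧ u₁ = 1 ∧ B = 1)) ∧
      U = sandwich u₂ A X u₁ B Y u₀ C := by
  obtain hd | hd | hd : a + b = 0 ∨ a + b = 1 ∨ a + b = 2 := by lia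
  · obtain ⟨rfl, rfl⟩ : a = 0 ∧ b = 0 := by lia
    obtain ⟨u, A, hu, hA, rfl⟩ := h.exists_of_zero
    -- Without couplings, two cancelling copies of `ctl zFst` are inserted.
    refine ⟨u, 1, 1, A, zFst, 1, zFst, 1, hu, isUnit_one, isUnit_one, hA.1, isUnit_one,
      isUnit_one, Or.inl rfl, Or.inl rfl, ?_⟩
    simp [sandwich, ctl_mul_ctl _ _ zFst_mul_self]
  · obtain ⟨u, A, X, V, a', b', k₁, k₂, hu, hA, hV, -, hX, rfl⟩ := h.exists_of_add_eq_succ hd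
    obtain ⟨rfl, rfl⟩ : a' = 0 ∧ b' = 0 := by lia
    obtain ⟨u', C, hu', hC, rfl⟩ := hV.exists_of_zero
    refine ⟨u, 1, u', A, X, 1, 1, C, hu, isUnit_one, hu', hA.1, isUnit_one, hC.1, by tauto,
      Or.inr (Or.inr ⟨rfl, rfl, rfl⟩), ?_⟩
    simp [sandwich, ctl_one]
  · obtain ⟨u, A, X, V, a', b', k₁, k₂, hu, hA, hV, -, hX, rfl⟩ := h.exists_of_add_eq_succ hd
    obtain ⟨u', B, Y, W, a'', b'', k₁', k₂', hu', hB, hW, -, hY, rfl⟩ :=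
      hV.exists_of_add_eq_succ (d := 0) (by lia)
    obtain ⟨rfl, rfl⟩ : a'' = 0 ∧ b'' = 0 := by lia
    obtain ⟨u'', C, hu'', hC, rfl⟩ := hW.exists_of_zero
    exact ⟨u, u', u'', A, X, B, Y, C, hu, hu', hu'', hA.1, hB.1, hC.1, by tauto, by tauto, rfl⟩

lemma Layered.exists_sandwich_of_one_one (h : Layered 1 1 k U) :
    ∃ (u₂ u₁ u₀ : Matrix (Fin 2) (Fin 2) ℂ)
      (A X B Y C : Matrix (Fin 2 × Fin 2) (Fin 2 × Fin 2) ℂ) (k₂ k₁ k₀ : ℕ),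
      IsUnit u₂ ∧ IsUnit u₁ ∧ IsUnit u₀ ∧ IsTwoQubit k₂ A ∧ IsTwoQubit k₁ B ∧ IsTwoQubit k₀ C ∧
      k₂ + k₁ + k₀ = k ∧ (X = zFst ∧ Y = zSnd ∨ X = zSnd ∧ Y = zFst) ∧
      U = sandwich u₂ A X u₁ B Y u₀ C := by
  obtain ⟨u, A, X, V, a', b', k₁, k₂, hu, hA, hV, rfl, hX, rfl⟩ :=
    h.exists_of_add_eq_succ (d := 1) rfl
  obtain ⟨u', B, Y, W, a'', b'', k₁', k₂', hu', hB, hW, rfl, hY, rfl⟩ :=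
    hV.exists_of_add_eq_succ (d := 0) (by lia)
  obtain ⟨rfl, rfl⟩ : a'' = 0 ∧ b'' = 0 := by lia
  obtain ⟨u'', C, hu'', hC, rfl⟩ := hW.exists_of_zero
  refine ⟨u, u', u'', A, X, B, Y, C, _, _, _, hu, hu', hu'', hA, hB, hC, by lia, ?_, rfl⟩
  rcases hX with ⟨rfl, h1, h2⟩ | ⟨rfl, h1, h2⟩ <;> rcases hY with ⟨rfl, h3, h4⟩ | ⟨rfl, h3, h4⟩
  · lia
  · exact Or.inl ⟨rfl, rfl⟩
  · exact Or.inr ⟨rfl, rfl⟩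
  · lia

lemma involution_of_eq {X : Matrix (Fin 2 × Fin 2) (Fin 2 × Fin 2) ℂ} (h : X = zFst ∨ X = zSnd) :
    X * X = 1 ∧ X.trace = 0 ∧ X.det = 1 := by
  rcases h with rfl | rfl
  exacts [⟨zFst_mul_self, trace_zFst, det_zFst⟩, ⟨zSnd_mul_self, trace_zSnd, det_zSnd⟩]

/-- At most one coupling to a distinguished qubit cannot give a block-diagonal operator that avoids
the span of involutions. -/
lemma AvoidsInvolutionSpan.two_le_add {V₀ V₁ : Matrix (Fin 2 × Fin 2) (Fin 2 × Fin 2) ℂ}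
    (hV : AvoidsInvolutionSpan V₀ V₁) (hV₀ : IsUnit V₀) (h₀₀ : qblock 0 0 U = V₀)
    (h₁₁ : qblock 1 1 U = V₁) (h₀₁ : qblock 0 1 U = 0) (h₁₀ : qblock 1 0 U = 0)
    (h : Layered a b k U) : 2 ≤ a + b := by
  by_contra! hlt
  have hr : ∀ {r : ℂ} {M : Matrix (Fin 2 × Fin 2) (Fin 2 × Fin 2) ℂ}, V₀ = r • M → r ≠ 0 := by
    rintro r M h rfl
    simp [h] at hV₀
  obtain hd | hd : a + b = 0 ∨ a + b = 1 := by lia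
  · obtain ⟨rfl, rfl⟩ : a = 0 ∧ b = 0 := by lia
    obtain ⟨u, A, hu, hA, rfl⟩ := h.exists_of_zero
    rw [qblock_kronecker] at h₀₀ h₁₁
    have := hr h₀₀.symm
    -- With no coupling the blocks are proportional, so any traceless involution serves with
    -- coefficient 0.
    refine hV zFst (u 1 1 / u 0 0) 0 zFst_mul_self trace_zFst ?_
    rw [← h₀₀, ← h₁₁]
    have hc : u 0 0 * (u 1 1 / u 0 0) = u 1 1 := by field_simp
    simp [smul_smul, hc]
  · obtain ⟨u, A, X, V, a', b', k₁, k₂, hu, hA, hV', -, hX, rfl⟩ := h.exists_of_add_eq_succ hd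
    obtain ⟨rfl, rfl⟩ : a' = 0 ∧ b' = 0 := by lia
    obtain ⟨u', C, hu', hC, rfl⟩ := hV'.exists_of_zero
    obtain ⟨hX1, hX2, -⟩ := involution_of_eq (X := X) (by tauto)
    have hs : (u ⊗ₖ A) * (ctl X * (u' ⊗ₖ C)) = sandwich u A X 1 1 1 u' C := by
      simp [sandwich, ctl_one]
    rw [hs] at h₀₀ h₁₁ h₀₁ h₁₀
    obtain ⟨A', C', r, s, hA', hC', e0, e1⟩ := hV.sandwich_form hV₀ h₀₀ h₁₁ h₀₁ h₁₀ hu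
      isUnit_one hu' hA.1 isUnit_one hC.1 hX1 hX2 (Matrix.one_mul 1)
    have hA'u : IsUnit A' := by
      rcases hA' with rfl | rfl
      exacts [hA.1, hA.1.mul (IsUnit.of_mul_eq_one _ hX1)]
    obtain ⟨D, hD⟩ := hA'u.exists_left_inv
    -- With one coupling (`Y = 1`), `V₁ V₀⁻¹` is a multiple of a conjugate of `X`.
    refine hV (A' * X * D) 0 (s / r) (conj_involution hD hX1) ((trace_conj hD X).trans hX2) ?_
    rw [e0, e1, zero_smul, zero_add, Matrix.smul_mul, Matrix.mul_smul, smul_smul,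
      div_mul_cancel₀ _ (hr e0)]
    congr 1
    calc A' * X * 1 * 1 * C' = A' * X * (D * A') * C' := by rw [hD]; simp
      _ = _ := by simp only [Matrix.mul_assoc, Matrix.one_mul]

theorem Layered.three_le_of_cx_cz (h₀₀ : qblock 0 0 U = cx₂) (h₁₁ : qblock 1 1 U = cx₂ * cz₂)
    (h₀₁ : qblock 0 1 U = 0) (h₁₀ : qblock 1 0 U = 0) (h : Layered a b k U) : 3 ≤ a + b := by
  by_contra! hlt
  have h2 := avoidsInvolutionSpan_cx_cz.two_le_add (IsUnit.of_mul_eq_one _ cx₂_mul_self)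
    h₀₀ h₁₁ h₀₁ h₁₀ h
  obtain ⟨u, A, X, V, a', b', k₁, k₂, hu, hA, hV, -, hX, rfl⟩ :=
    h.exists_of_add_eq_succ (d := 1) (by lia)
  obtain ⟨u', B, Y, W, a'', b'', k₁', k₂', hu', hB, hW, -, hY, rfl⟩ :=
    hV.exists_of_add_eq_succ (d := 0) (by lia)
  obtain ⟨rfl, rfl⟩ : a'' = 0 ∧ b'' = 0 := by lia
  obtain ⟨u'', C, hu'', hC, rfl⟩ := hW.exists_of_zero
  obtain ⟨hX1, hX2, hX3⟩ := involution_of_eq (X := X) (by tauto)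
  obtain ⟨hY1, hY2, hY3⟩ := involution_of_eq (X := Y) (by tauto)
  exact not_sandwich_cx_cz h₀₀ h₁₁ h₀₁ h₁₀ hu hu' hu'' hA.1 hB.1 hC.1 hX1 hX2 hX3 hY1 hY3

theorem Layered.three_le_of_isFlipMultiplexer {ε : ℂ} (hε : ε ≠ 0) (hU : IsFlipMultiplexer ε U)
    (hU' : IsFlipMultiplexer (-ε) Uᵀ) (h : Layered a b k U) : 3 ≤ a + b := by
  by_contra! hlt
  obtain ⟨u₂, u₁, u₀, A, X, B, Y, C, hu₂, hu₁, hu₀, hA, hB, hC, hX, hY, rfl⟩ :=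
    h.exists_sandwich_of_le_two (by lia)
  obtain ⟨hX1, hX2, -⟩ := involution_of_eq hX
  by_cases hY' : Y = zFst ∨ Y = zSnd
  · obtain ⟨hY1, hY2, -⟩ := involution_of_eq hY'
    exact not_isFlipMultiplexer_sandwich hu₂ hu₀ hA hB hC hX1 hX2 hY1 hY2 hε hU hU'
  · obtain ⟨rfl, rfl, rfl⟩ : Y = 1 ∧ u₁ = 1 ∧ B = 1 := by tauto
    obtain ⟨w, hw⟩ := hu₀.exists_right_inv
    obtain ⟨t, ht⟩ := hu₂.exists_left_inv
    -- A missing second coupling means `u₁ = 1`, whose off-diagonal entry is 0.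
    exact hU.ne_zero hε hw ht 0 1 (by simp)

theorem Layered.three_le_of_xcz (h₀₀ : qblock 0 0 U = 1) (h₁₁ : qblock 1 1 U = xcz₂)
    (h₀₁ : qblock 0 1 U = 0) (h₁₀ : qblock 1 0 U = 0) (h : Layered 1 1 k U) : 3 ≤ k := by
  by_contra! hlt
  obtain ⟨u₂, u₁, u₀, A, X, B, Y, C, k₂, k₁, k₀, hu₂, hu₁, hu₀, hA, hB, hC, hk, hXY, rfl⟩ :=
    h.exists_sandwich_of_one_one
  have hX : X = zFst ∨ X = zSnd := by tauto
  have hY : Y = zFst ∨ Y = zSnd := by tauto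
  obtain ⟨hX1, hX2, -⟩ := involution_of_eq hX
  obtain ⟨hY1, -, -⟩ := involution_of_eq hY
  have hXl : IsLocal X := by
    rcases hX with rfl | rfl
    exacts [isLocal_zFst, isLocal_zSnd]
  have hYl : IsLocal Y := by
    rcases hY with rfl | rfl
    exacts [isLocal_zFst, isLocal_zSnd]
  obtain ⟨A', C', r, s, hA', hC', e0, e1⟩ := avoidsInvolutionSpan_one_xcz.sandwich_form
    isUnit_one h₀₀ h₁₁ h₀₁ h₁₀ hu₂ hu₁ hu₀ hA.1 hB.1 hC.1 hX1 hX2 hY1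
  have hA'' : IsTwoQubit k₂ A' := by
    rcases hA' with rfl | rfl
    exacts [hA, hA.mul (hXl.isTwoQubit 0)]
  have hC'' : IsTwoQubit k₀ C' := by
    rcases hC' with rfl | rfl
    · exact hC
    · simpa using (hYl.isTwoQubit 0).mul hC
  obtain ⟨n1, n2, n3⟩ := xcz₂_form_not_local hXY hA''.1 hB.1 hC''.1 e0 e1
  -- Fewer than three gates leave one of the three layers without a two-qubit gate, hence local.
  obtain h0 | h0 | h0 : k₂ = 0 ∨ k₁ = 0 ∨ k₀ = 0 := by lia
  exacts [n1 (hA''.2 h0), n2 (hB.2 h0), n3 (hC''.2 h0)]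

end Layers

/-! ### Gates in an arbitrary ordering of the qubits -/

section Frames

lemma ctl_diagonal {ι : Type*} [Fintype ι] [DecidableEq ι] (d : ι → ℂ) :
    ctl (diagonal d) = diagonal fun p => if p.1 = 0 then 1 else d p.2 := by
  ext ⟨a, i⟩ ⟨b, j⟩
  fin_cases a <;> fin_cases b <;> simp [ctl, diagonal_apply, Matrix.one_apply]

/-- The bit string with the bits `p` at the positions `q`, `r` and the rest. -/
def bitString (q r : Fin 3) (p : Fin 2 × Fin 2 × Fin 2) : Fin 3 → Fin 2 :=
  fun k => if k = q then p.1 else if k = r then p.2.1 else p.2.2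

variable {q r s : Fin 3}

lemma bitString_fst (p : Fin 2 × Fin 2 × Fin 2) : bitString q r p q = p.1 := by
  simp [bitString]

lemma bitString_snd (hqr : q ≠ r) (p : Fin 2 × Fin 2 × Fin 2) : bitString q r p r = p.2.1 := by
  simp [bitString, hqr.symm]

lemma bitString_thd (hqs : q ≠ s) (hrs : r ≠ s) (p : Fin 2 × Fin 2 × Fin 2) :
    bitString q r p s = p.2.2 := by
  simp [bitString, hqs.symm, hrs.symm]

lemma eq_or_eq_or_eq (hqr : q ≠ r) (hqs : q ≠ s) (hrs : r ≠ s) (k : Fin 3) :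
    k = q ∨ k = r ∨ k = s := by lia

lemma forall_iff (hqr : q ≠ r) (hqs : q ≠ s) (hrs : r ≠ s) {P : Fin 3 → Prop} :
    (∀ k, P k) ↔ P q ∧ P r ∧ P s := by
  refine ⟨fun h => ⟨h q, h r, h s⟩, fun ⟨h1, h2, h3⟩ k => ?_⟩
  rcases eq_or_eq_or_eq hqr hqs hrs k with rfl | rfl | rfl <;> assumption

/-- Bit strings as triples of bits, in a given order of the positions. -/
def bitEquiv (hqr : q ≠ r) (hqs : q ≠ s) (hrs : r ≠ s) :
    (Fin 3 → Fin 2) ≃ Fin 2 × Fin 2 × Fin 2 where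
  toFun x := (x q, x r, x s)
  invFun := bitString q r
  left_inv x := by
    rw [funext_iff, forall_iff hqr hqs hrs]
    simp [bitString_fst, bitString_snd hqr, bitString_thd hqs hrs]
  right_inv p := by
    simp [bitString_fst, bitString_snd hqr, bitString_thd hqs hrs]

/-- Operators on three qubits, with the qubits in a given order. -/
noncomputable def frame (hqr : q ≠ r) (hqs : q ≠ s) (hrs : r ≠ s) :
    QOp 3 ≃ₐ[ℂ] Matrix (Fin 2 × Fin 2 × Fin 2) (Fin 2 × Fin 2 × Fin 2) ℂ :=
  Matrix.reindexAlgEquiv ℂ ℂ (bitEquiv hqr hqs hrs)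

variable (hqr : q ≠ r) (hqs : q ≠ s) (hrs : r ≠ s)

lemma frame_apply (U : QOp 3) (x y : Fin 2 × Fin 2 × Fin 2) :
    frame hqr hqs hrs U x y = U (bitString q r x) (bitString q r y) := rfl

lemma frame_onQubit_fst (g : Matrix (Fin 2) (Fin 2) ℂ) :
    frame hqr hqs hrs (QOp.onQubit q g) = g ⊗ₖ 1 := by
  ext ⟨a, b, c⟩ ⟨a', b', c'⟩
  simp [frame_apply, QOp.onQubit, forall_iff hqr hqs hrs, bitString_fst, bitString_snd hqr,
    bitString_thd hqs hrs, hqr.symm, hqs.symm, Matrix.one_apply]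

lemma frame_onQubit_snd (g : Matrix (Fin 2) (Fin 2) ℂ) :
    frame hqr hqs hrs (QOp.onQubit r g) = 1 ⊗ₖ (g ⊗ₖ 1) := by
  ext ⟨a, b, c⟩ ⟨a', b', c'⟩
  simp [frame_apply, QOp.onQubit, forall_iff hqr hqs hrs, bitString_fst, bitString_snd hqr,
    bitString_thd hqs hrs, hqr, hrs.symm, Matrix.one_apply, ite_and]
  split_ifs <;> rfl

lemma frame_onQubit_thd (g : Matrix (Fin 2) (Fin 2) ℂ) :
    frame hqr hqs hrs (QOp.onQubit s g) = 1 ⊗ₖ (1 ⊗ₖ g) := by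
  ext ⟨a, b, c⟩ ⟨a', b', c'⟩
  simp [frame_apply, QOp.onQubit, forall_iff hqr hqs hrs, bitString_fst, bitString_snd hqr,
    bitString_thd hqs hrs, hqs, hrs, Matrix.one_apply, ite_and]
  split_ifs <;> rfl

lemma frame_diagonal (d : (Fin 3 → Fin 2) → ℂ) :
    frame hqr hqs hrs (diagonal d) = diagonal (d ∘ bitString q r) := by
  have hinj : Function.Injective (bitString q r) := (bitEquiv hqr hqs hrs).symm.injective
  ext x y
  simp [frame_apply, diagonal_apply, hinj.eq_iff]

lemma frame_CZ_fst_snd : frame hqr hqs hrs (QOp.CZ q r) = ctl zFst := by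
  have hz : zFst = diagonal fun p => if p.1 = 1 then -1 else 1 := by
    ext ⟨a, i⟩ ⟨b, j⟩
    fin_cases a <;> fin_cases b <;> simp [zFst, pauliZ, diagonal_apply, Matrix.one_apply]
  rw [QOp.CZ, frame_diagonal, hz, ctl_diagonal]
  congr 1
  ext ⟨a, b, c⟩
  fin_cases a <;> simp [bitString_fst, bitString_snd hqr]

lemma frame_CZ_fst_thd : frame hqr hqs hrs (QOp.CZ q s) = ctl zSnd := by
  have hz : zSnd = diagonal fun p => if p.2 = 1 then -1 else 1 := by
    ext ⟨a, i⟩ ⟨b, j⟩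
    by_cases h : a = b <;> fin_cases i <;> fin_cases j <;> simp [zSnd, pauliZ, h]
  rw [QOp.CZ, frame_diagonal, hz, ctl_diagonal]
  congr 1
  ext ⟨a, b, c⟩
  fin_cases a <;> simp [bitString_fst, bitString_thd hqs hrs]

lemma frame_CZ_snd_thd : frame hqr hqs hrs (QOp.CZ r s) = 1 ⊗ₖ cz₂ := by
  rw [QOp.CZ, frame_diagonal, cz₂, ← diagonal_one, diagonal_kronecker_diagonal]
  congr 1
  ext ⟨a, b, c⟩
  simp [bitString_snd hqr, bitString_thd hqs hrs]

/-- The controlled-controlled-`Z` on three qubits. -/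
def ccz (q r s : Fin 3) : QOp 3 :=
  diagonal fun x => if x q = 1 ∧ x r = 1 ∧ x s = 1 then -1 else 1

lemma frame_ccz : frame hqr hqs hrs (ccz q r s) = ctl cz₂ := by
  rw [ccz, frame_diagonal, cz₂, ctl_diagonal]
  congr 1
  ext ⟨a, b, c⟩
  fin_cases a <;> simp [bitString_fst, bitString_snd hqr, bitString_thd hqs hrs]

lemma bitString_eq_iff (hqr : q ≠ r) (hqs : q ≠ s) (hrs : r ≠ s) {x : Fin 2 × Fin 2 × Fin 2} {f : Fin 3 → Fin 2} :
    bitString q r x = f ↔ x.1 = f q ∧ x.2.1 = f r ∧ x.2.2 = f s := by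
  rw [funext_iff, forall_iff hqr hqs hrs, bitString_fst, bitString_snd hqr, bitString_thd hqs hrs]

lemma frame_CX_fst_snd : frame hqr hqs hrs (QOp.CX q r) = ctl (pauliX ⊗ₖ 1) := by
  ext ⟨a, b, c⟩ ⟨a', b', c'⟩
  simp only [frame_apply, QOp.CX, QOp.ofMap, Matrix.of_apply, bitString_eq_iff hqr hqs hrs]
  simp only [Function.update_of_ne hqr, Function.update_self, Function.update_of_ne hrs.symm,
    bitString_fst, bitString_snd hqr, bitString_thd hqs hrs]
  fin_cases a <;> fin_cases a' <;> fin_cases b <;> fin_cases b' <;>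
    simp [ctl, pauliX, Matrix.one_apply]

lemma frame_CX_snd_thd : frame hqr hqs hrs (QOp.CX r s) = 1 ⊗ₖ cx₂ := by
  ext ⟨a, b, c⟩ ⟨a', b', c'⟩
  simp only [frame_apply, QOp.CX, QOp.ofMap, Matrix.of_apply, bitString_eq_iff hqr hqs hrs]
  simp only [Function.update_of_ne hqs, Function.update_self, Function.update_of_ne hrs,
    bitString_fst, bitString_snd hqr, bitString_thd hqs hrs]
  fin_cases b <;> fin_cases b' <;> fin_cases c <;> fin_cases c' <;>
    simp [cx₂, ctl, pauliX, Matrix.one_apply]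

lemma qblock_frame_CX_snd_fst (a b : Fin 2) : qblock a b (frame hqr hqs hrs (QOp.CX r q)) =
    diagonal fun p => if a = b + p.1 then 1 else 0 := by
  ext ⟨c, d⟩ ⟨c', d'⟩
  simp only [qblock, Matrix.submatrix_apply, frame_apply, QOp.CX, QOp.ofMap, Matrix.of_apply,
    bitString_eq_iff hqr hqs hrs]
  simp only [Function.update_of_ne hqr.symm, Function.update_self, Function.update_of_ne hqs.symm,
    bitString_fst, bitString_snd hqr, bitString_thd hqs hrs, diagonal_apply, Prod.mk.injEq]
  by_cases h1 : c = c' <;> by_cases h2 : d = d' <;> simp [h1, h2]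

lemma frame_CCX_snd_thd_fst : frame hqr hqs hrs (QOp.CCX r s q) =
    (1 : Matrix (Fin 2) (Fin 2) ℂ) ⊗ₖ (diagonal fun p => if p.1 = 1 ∧ p.2 = 1 then 0 else 1) +
      pauliX ⊗ₖ (diagonal fun p => if p.1 = 1 ∧ p.2 = 1 then 1 else 0) := by
  ext ⟨a, b, c⟩ ⟨a', b', c'⟩
  simp only [frame_apply, QOp.CCX, QOp.ofMap, Matrix.of_apply, bitString_eq_iff hqr hqs hrs]
  simp only [Function.update_of_ne hqr.symm, Function.update_self, Function.update_of_ne hqs.symm,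
    bitString_fst, bitString_snd hqr, bitString_thd hqs hrs]
  fin_cases a <;> fin_cases a' <;> fin_cases b <;> fin_cases b' <;> fin_cases c <;> fin_cases c' <;>
    simp [pauliX]

end Frames

/-! ### From circuits to layers, and the count of five -/

section LowerBound

/-- The Hadamard gate. -/
noncomputable def hadamardGate : Matrix (Fin 2) (Fin 2) ℂ := ((√2 : ℝ) : ℂ)⁻¹ • !![1, 1; 1, -1]

lemma inv_sqrt_two_mul_self : ((√2 : ℝ) : ℂ)⁻¹ * ((√2 : ℝ) : ℂ)⁻¹ = 1 / 2 := by
  rw [← mul_inv, ← Complex.ofReal_mul, Real.mul_self_sqrt (by norm_num)]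
  norm_num

lemma hadamard_mul_self : hadamardGate * hadamardGate = 1 := by
  rw [hadamardGate, Matrix.smul_mul, Matrix.mul_smul, smul_smul, inv_sqrt_two_mul_self]
  ext i j
  fin_cases i <;> fin_cases j <;> norm_num

lemma hadamard_conj_pauliX : hadamardGate * pauliX * hadamardGate = pauliZ := by
  rw [hadamardGate, Matrix.smul_mul, Matrix.smul_mul, Matrix.mul_smul, smul_smul, inv_sqrt_two_mul_self]
  ext i j
  fin_cases i <;> fin_cases j <;> norm_num [pauliX, pauliZ]

lemma hadamard_conj_pauliZ : hadamardGate * pauliZ * hadamardGate = pauliX := by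
  rw [hadamardGate, Matrix.smul_mul, Matrix.smul_mul, Matrix.mul_smul, smul_smul, inv_sqrt_two_mul_self]
  ext i j
  fin_cases i <;> fin_cases j <;> norm_num [pauliX, pauliZ]

lemma star_hadamard : star hadamardGate = hadamardGate := by
  ext i j
  fin_cases i <;> fin_cases j <;> simp [hadamardGate, Matrix.star_apply]

/-- The Hadamard gate as a unitary. -/
noncomputable def hadamardU : Matrix.unitaryGroup (Fin 2) ℂ :=
  ⟨hadamardGate, by rw [Matrix.mem_unitaryGroup_iff, star_hadamard, hadamard_mul_self]⟩

variable {q r s : Fin 3} (hqr : q ≠ r) (hqs : q ≠ s) (hrs : r ≠ s)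

lemma exists_third (hqr : q ≠ r) : ∃ s, q ≠ s ∧ r ≠ s := by
  decide +revert

/-- The gate is a controlled-`Z` on the qubits `i` and `j`. -/
def QGate.isCZOn {N : ℕ} (i j : Fin N) : QGate N → Bool
  | .cz a b _ => decide (a = i ∧ b = j ∨ a = j ∧ b = i)
  | _ => false

lemma CZ_comm {N : ℕ} (i j : Fin N) : QOp.CZ i j = QOp.CZ j i := by
  simp [QOp.CZ, and_comm]

lemma isUnit_unitary (g : Matrix.unitaryGroup (Fin 2) ℂ) :
    IsUnit (g : Matrix (Fin 2) (Fin 2) ℂ) :=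
  IsUnit.of_mul_eq_one _ (Matrix.mem_unitaryGroup_iff.1 g.2)

/-- Used with each of the three qubits in the role of `q`, so that one circuit yields three
inequalities on the same pair counts. -/
lemma layered_frame_toOp (c : QCircuit 3) (hc : c.IsCZCircuit) :
    Layered (c.countP (QGate.isCZOn q r)) (c.countP (QGate.isCZOn q s))
      (c.countP (QGate.isCZOn r s)) (frame hqr hqs hrs c.toOp) := by
  induction c with
  | nil =>
    have := Layered.base isUnit_one (isLocal_one.isTwoQubit 0)
    simpa [QCircuit.toOp] using this
  | cons g c ih =>
    have ih := ih fun x hx => hc x (List.mem_cons_of_mem _ hx)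
    have e : QCircuit.toOp (g :: c) = g.toOp * QCircuit.toOp c := by simp [QCircuit.toOp]
    rw [e, map_mul]
    cases g with
    | single p u =>
      have hu := isUnit_unitary u
      simp only [QGate.toOp, List.countP_cons, QGate.isCZOn, Bool.false_eq_true, if_false, add_zero]
      rcases eq_or_eq_or_eq hqr hqs hrs p with rfl | rfl | rfl
      · rw [frame_onQubit_fst]
        simpa using ih.left_mul hu (isLocal_one.isTwoQubit 0)
      · rw [frame_onQubit_snd]
        simpa using ih.left_mul isUnit_one
          (IsLocal.isTwoQubit ⟨u, 1, hu, isUnit_one, rfl⟩ 0)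
      · rw [frame_onQubit_thd]
        simpa using ih.left_mul isUnit_one
          (IsLocal.isTwoQubit ⟨1, u, isUnit_one, hu, rfl⟩ 0)
    | cz i j h =>
      have key : ∀ i j, i ≠ j → (i = q ∧ j = r ∨ i = q ∧ j = s ∨ i = r ∧ j = s) ∨
          (j = q ∧ i = r ∨ j = q ∧ i = s ∨ j = r ∧ i = s) := by
        intro i j hij
        rcases eq_or_eq_or_eq hqr hqs hrs i with rfl | rfl | rfl <;>
          rcases eq_or_eq_or_eq hqr hqs hrs j with rfl | rfl | rfl <;> simp_all
      have fst := ih.ctl_zFst_mul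
      have snd := ih.ctl_zSnd_mul
      have thd := ih.left_mul isUnit_one isTwoQubit_cz₂
      rw [add_comm 1] at thd
      simp only [QGate.toOp, List.countP_cons, QGate.isCZOn]
      rcases key i j h with (⟨rfl, rfl⟩ | ⟨rfl, rfl⟩ | ⟨rfl, rfl⟩) |
        (⟨rfl, rfl⟩ | ⟨rfl, rfl⟩ | ⟨rfl, rfl⟩)
      · rw [frame_CZ_fst_snd]
        simpa [hqr, hqs, hrs, hqr.symm, hqs.symm, hrs.symm] using fst
      · rw [frame_CZ_fst_thd]
        simpa [hqr, hqs, hrs, hqr.symm, hqs.symm, hrs.symm] using snd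
      · rw [frame_CZ_snd_thd]
        simpa [hqr, hqs, hrs, hqr.symm, hqs.symm, hrs.symm] using thd
      · rw [CZ_comm, frame_CZ_fst_snd]
        simpa [hqr, hqs, hrs, hqr.symm, hqs.symm, hrs.symm] using fst
      · rw [CZ_comm, frame_CZ_fst_thd]
        simpa [hqr, hqs, hrs, hqr.symm, hqs.symm, hrs.symm] using snd
      · rw [CZ_comm, frame_CZ_snd_thd]
        simpa [hqr, hqs, hrs, hqr.symm, hqs.symm, hrs.symm] using thd
    | cnot i j h =>
      have := hc _ List.mem_cons_self
      simp [QGate.isSingle, QGate.isCZ] at this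

lemma QGate.isCZOn_comm {N : ℕ} (i j : Fin N) : QGate.isCZOn i j = QGate.isCZOn j i := by
  ext g
  cases g <;> simp [QGate.isCZOn, or_comm]

lemma numCZ_eq (hqr : q ≠ r) (hqs : q ≠ s) (hrs : r ≠ s) (c : QCircuit 3) :
    c.numCZ = c.countP (QGate.isCZOn q r) + c.countP (QGate.isCZOn q s) +
      c.countP (QGate.isCZOn r s) := by
  induction c with
  | nil => rfl
  | cons g c ih =>
    simp only [QCircuit.numCZ, List.countP_cons] at ih ⊢
    rw [ih]
    cases g with
    | single p u => simp [QGate.isCZOn, QGate.isCZ]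
    | cnot i j h => simp [QGate.isCZOn, QGate.isCZ]
    | cz i j h =>
      simp only [QGate.isCZOn, QGate.isCZ]
      rcases eq_or_eq_or_eq hqr hqs hrs i with rfl | rfl | rfl <;>
        rcases eq_or_eq_or_eq hqr hqs hrs j with rfl | rfl | rfl <;>
        simp_all <;> lia

lemma qblock_one_kronecker_mul_ctl {ι : Type*} [Fintype ι] [DecidableEq ι] (A X : Matrix ι ι ℂ)
    (a b : Fin 2) : qblock a b (((1 : Matrix (Fin 2) (Fin 2) ℂ) ⊗ₖ A) * ctl X) =
      if a = b then A * X ^ (a : ℕ) else 0 := by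
  fin_cases a <;> fin_cases b <;> simp [qblock_mul, qblock_kronecker, qblock_ctl]

lemma qblock_ctl_mul_ctl {ι : Type*} [Fintype ι] [DecidableEq ι] (X Y : Matrix ι ι ℂ)
    (a b : Fin 2) : qblock a b (ctl X * ctl Y) = if a = b then X ^ (a : ℕ) * Y ^ (a : ℕ) else 0 := by
  fin_cases a <;> fin_cases b <;> simp [qblock_mul, qblock_ctl]

/-- The Peres operator, up to Hadamard gates on its last qubit. -/
def peresZ (l m n : Fin 3) : QOp 3 := QOp.CX l m * ccz l m n

lemma ccz_rotate (l m n : Fin 3) : ccz l m n = ccz n l m := by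
  simp only [ccz]
  congr 1
  ext x
  congr 1
  simp only [eq_iff_iff]
  tauto

lemma ccz_swap (l m n : Fin 3) : ccz l m n = ccz m l n := by
  simp only [ccz]
  congr 1
  ext x
  congr 1
  simp only [eq_iff_iff]
  tauto

lemma ctl_cz₂_eq : ctl cz₂ =
    (1 : Matrix (Fin 2) (Fin 2) ℂ) ⊗ₖ (diagonal fun p => if p.1 = 1 ∧ p.2 = 1 then 0 else 1) +
      pauliZ ⊗ₖ (diagonal fun p => if p.1 = 1 ∧ p.2 = 1 then 1 else 0) := by
  rw [cz₂, ctl_diagonal]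
  ext ⟨a, i, j⟩ ⟨b, i', j'⟩
  fin_cases a <;> fin_cases b <;> fin_cases i <;> fin_cases i' <;> fin_cases j <;> fin_cases j' <;>
    simp [pauliZ]

lemma onQubit_hadamard_mul_self (hqr : q ≠ r) (hqs : q ≠ s) (hrs : r ≠ s) :
    QOp.onQubit q hadamardGate * QOp.onQubit q hadamardGate = 1 := by
  apply (frame hqr hqs hrs).injective
  rw [map_mul, frame_onQubit_fst, ← Matrix.mul_kronecker_mul, hadamard_mul_self, Matrix.one_mul,
    Matrix.one_kronecker_one, map_one]

lemma hadamard_conj_PERES {l m n : Fin 3} (hlm : l ≠ m) (hln : l ≠ n) (hmn : m ≠ n) :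
    QOp.onQubit n hadamardGate * QOp.PERES l m n * QOp.onQubit n hadamardGate = peresZ l m n := by
  apply (frame hln.symm hmn.symm hlm).injective
  rw [QOp.PERES, peresZ, ccz_rotate]
  simp only [map_mul, frame_onQubit_fst, frame_CX_snd_thd, frame_CCX_snd_thd_fst, frame_ccz,
    ctl_cz₂_eq, Matrix.mul_add, Matrix.add_mul, ← Matrix.mul_kronecker_mul, Matrix.one_mul,
    Matrix.mul_one, hadamard_mul_self, hadamard_conj_pauliX]

theorem five_le_numCZ {l m n : Fin 3} (hlm : l ≠ m) (hln : l ≠ n) (hmn : m ≠ n) (c : QCircuit 3)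
    (hc : c.IsCZCircuit) (h : c.toOp = QOp.PERES l m n) : 5 ≤ c.numCZ := by
  -- The two added Hadamard gates cost no CZ and turn the operator into `peresZ`.
  set c' : QCircuit 3 := .single n hadamardU :: (c ++ [.single n hadamardU])
  have hc' : c'.IsCZCircuit := by
    intro g hg
    simp only [c', List.mem_cons, List.mem_append, List.not_mem_nil, or_false] at hg
    rcases hg with rfl | hg | rfl
    exacts [Or.inl rfl, hc g hg, Or.inl rfl]
  have hn : c'.numCZ = c.numCZ := by
    simp [c', QCircuit.numCZ, QGate.isCZ]
  have ht : c'.toOp = peresZ l m n := by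
    rw [← hadamard_conj_PERES hlm hln hmn, ← h]
    simp [c', QCircuit.toOp, QGate.toOp, hadamardU, Matrix.mul_assoc]
  clear_value c'
  rw [← hn]
  have hcount := numCZ_eq hlm hln hmn c'
  have e1 := layered_frame_toOp hlm hln hmn c' hc'
  have e2 := layered_frame_toOp hlm.symm hmn hln c' hc'
  have e3 := layered_frame_toOp hln.symm hmn.symm hlm c' hc'
  rw [QGate.isCZOn_comm m l] at e2
  rw [QGate.isCZOn_comm n l, QGate.isCZOn_comm n m] at e3
  rw [ht] at e1 e2 e3
  have f1 : ∀ a b, qblock a b (frame hlm hln hmn (peresZ l m n)) =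
      if a = b then (pauliX ⊗ₖ 1) ^ (a : ℕ) * cz₂ ^ (a : ℕ) else 0 := by
    intro a b
    rw [peresZ, map_mul, frame_CX_fst_snd, frame_ccz, qblock_ctl_mul_ctl]
  have f3 : ∀ a b, qblock a b (frame hln.symm hmn.symm hlm (peresZ l m n)) =
      if a = b then cx₂ * cz₂ ^ (a : ℕ) else 0 := by
    intro a b
    rw [peresZ, map_mul, frame_CX_snd_thd, ccz_rotate, frame_ccz, qblock_one_kronecker_mul_ctl]
  have f2 : ∀ a b, qblock a b (frame hlm.symm hmn hln (peresZ l m n)) =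
      diagonal fun p => (if a = b + p.1 then 1 else 0) *
        if b = 1 ∧ p.1 = 1 ∧ p.2 = 1 then -1 else 1 := by
    intro a b
    rw [peresZ, map_mul, ccz_swap, frame_ccz, qblock_mul]
    simp only [qblock_frame_CX_snd_fst, qblock_ctl, Fin.sum_univ_two]
    fin_cases b <;> simp [cz₂]
  have d1 : 2 ≤ _ + _ := avoidsInvolutionSpan_one_xcz.two_le_add isUnit_one (by simp [f1])
    (by simp [f1, xcz₂]) (by simp [f1]) (by simp [f1]) e1
  have d3 := e3.three_le_of_cx_cz (by simp [f3]) (by simp [f3]) (by simp [f3]) (by simp [f3])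
  have f2' : ∀ a b, qblock a b (frame hlm.symm hmn hln (peresZ l m n))ᵀ =
      diagonal fun p => (if b = a + p.1 then 1 else 0) *
        if a = 1 ∧ p.1 = 1 ∧ p.2 = 1 then -1 else 1 := by
    intro a b
    rw [← Matrix.diagonal_transpose, ← f2]
    rfl
  have d2 := e2.three_le_of_isFlipMultiplexer (ε := -1) (by simp)
    (by constructor <;> rw [f2] <;> congr 1 <;> ext ⟨i, j⟩ <;> fin_cases i <;> fin_cases j <;> simp)
    (by constructor <;> rw [f2'] <;> congr 1 <;> ext ⟨i, j⟩ <;> fin_cases i <;> fin_cases j <;> simp)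
  by_contra! hlt
  -- The bounds 2, 3, 3 on the pairwise sums leave only the counts 1, 1, 2.
  have g1 : c'.countP (QGate.isCZOn l m) = 1 := by lia
  have g2 : c'.countP (QGate.isCZOn l n) = 1 := by lia
  rw [g1, g2] at e1
  have := e1.three_le_of_xcz (by simp [f1]) (by simp [f1, xcz₂]) (by simp [f1]) (by simp [f1])
  lia

end LowerBound

/-! ### Exchanging CNOT gates for CZ gates -/

section Conversion

lemma kronecker_mul_ctl_mul_kronecker {ι : Type*} [Fintype ι] [DecidableEq ι] {P Q X : Matrix ι ι ℂ}
    (h : P * Q = 1) :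
    ((1 : Matrix (Fin 2) (Fin 2) ℂ) ⊗ₖ P) * ctl X * ((1 : Matrix (Fin 2) (Fin 2) ℂ) ⊗ₖ Q) =
      ctl (P * X * Q) := by
  ext ⟨a, i⟩ ⟨b, j⟩
  have : ∀ V W : Matrix (Fin 2 × ι) (Fin 2 × ι) ℂ,
      qblock a b V = qblock a b W → V (a, i) (b, j) = W (a, i) (b, j) :=
    fun V W h => congrFun (congrFun h i) j
  apply this
  rw [qblock_mul, Fin.sum_univ_two]
  simp only [qblock_one_kronecker_mul_ctl, qblock_kronecker, qblock_ctl]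
  obtain rfl | rfl : a = 0 ∨ a = 1 := by lia
  all_goals obtain rfl | rfl : b = 0 ∨ b = 1 := by lia
  all_goals simp [h]

lemma CX_eq_hadamard_conj {q r : Fin 3} (hqr : q ≠ r) :
    QOp.CX q r = QOp.onQubit r hadamardGate * (QOp.CZ q r * QOp.onQubit r hadamardGate) := by
  obtain ⟨s, hqs, hrs⟩ := exists_third hqr
  apply (frame hqr hqs hrs).injective
  rw [← mul_assoc, map_mul, map_mul, frame_CX_fst_snd, frame_onQubit_snd, frame_CZ_fst_snd,
    kronecker_mul_ctl_mul_kronecker, zFst, ← Matrix.mul_kronecker_mul, ← Matrix.mul_kronecker_mul,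
    hadamard_conj_pauliZ, Matrix.one_mul, Matrix.one_mul]
  rw [← Matrix.mul_kronecker_mul, hadamard_mul_self, Matrix.one_mul, Matrix.one_kronecker_one]

/-- Replacement of a `CNOT` gate by a `CZ` gate and two Hadamard gates. -/
noncomputable def QGate.toCZ : QGate 3 → QCircuit 3
  | .cnot i j h => [.single j hadamardU, .cz i j h, .single j hadamardU]
  | g => [g]

lemma toOp_flatMap_toCZ (c : QCircuit 3) :
    QCircuit.toOp (c.flatMap QGate.toCZ) = QCircuit.toOp c := by
  induction c with
  | nil => rfl
  | cons g c ih =>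
    simp only [QCircuit.toOp, List.flatMap_cons, List.map_append, List.prod_append, List.map_cons,
      List.prod_cons] at ih ⊢
    rw [ih]
    cases g with
    | single p u => simp [QGate.toCZ]
    | cz i j h => simp [QGate.toCZ]
    | cnot i j h => simp [QGate.toCZ, QGate.toOp, hadamardU, CX_eq_hadamard_conj h]

lemma isCZCircuit_flatMap_toCZ {c : QCircuit 3} (hc : c.IsCNOTCircuit) :
    QCircuit.IsCZCircuit (c.flatMap QGate.toCZ) := by
  intro g hg
  obtain ⟨g', hg', h⟩ := List.mem_flatMap.1 hg
  have := hc g' hg'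
  cases g' <;> simp [QGate.toCZ, QGate.isSingle, QGate.isCNOT] at h this
  · simp [h, QGate.isSingle]
  · rcases h with rfl | rfl | rfl <;> simp [QGate.isSingle, QGate.isCZ]

lemma numCZ_flatMap_toCZ {c : QCircuit 3} (hc : c.IsCNOTCircuit) :
    QCircuit.numCZ (c.flatMap QGate.toCZ) = c.numCNOT := by
  induction c with
  | nil => rfl
  | cons g c ih =>
    have ih := ih fun x hx => hc x (List.mem_cons_of_mem _ hx)
    have hg := hc g List.mem_cons_self
    simp only [QCircuit.numCZ, QCircuit.numCNOT, List.flatMap_cons, List.countP_append,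
      List.countP_cons] at ih ⊢
    rw [ih]
    cases g <;> simp_all [List.countP_cons, QGate.toCZ, QGate.isSingle, QGate.isCNOT, QGate.isCZ, add_comm]

end Conversion

/-! ### A circuit with five CNOT gates -/

section UpperBound

variable {N : ℕ}

/-- The operator sending each basis vector `|y⟩` to `d y` times the basis vector `|f y⟩`. -/
def monomialOp (f : (Fin N → Fin 2) → (Fin N → Fin 2)) (d : (Fin N → Fin 2) → ℂ) : QOp N :=
  Matrix.of fun x y => if x = f y then d y else 0

lemma monomialOp_mul (f g : (Fin N → Fin 2) → (Fin N → Fin 2)) (d e : (Fin N → Fin 2) → ℂ) :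
    monomialOp f d * monomialOp g e = monomialOp (fun y => f (g y)) fun y => d (g y) * e y := by
  ext x y
  simp [monomialOp, Matrix.mul_apply]

/-- The phase gate with phase `t`. -/
def phaseGate (t : ℂ) : Matrix (Fin 2) (Fin 2) ℂ := !![1, 0; 0, t]

lemma onQubit_phaseGate (q : Fin N) (t : ℂ) :
    QOp.onQubit q (phaseGate t) = monomialOp (fun y => y) fun y => if y q = 0 then 1 else t := by
  ext x y
  by_cases hxy : x = y
  · subst hxy
    simp only [QOp.onQubit, monomialOp, Matrix.of_apply, implies_true, if_true]
    generalize x q = a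
    fin_cases a <;> simp [phaseGate]
  · have : (∀ k, k ≠ q → x k = y k) → x q ≠ y q := by
      intro h h'
      apply hxy
      ext k
      by_cases hk : k = q
      · rw [hk, h']
      · rw [h k hk]
    by_cases hk : ∀ k, k ≠ q → x k = y k
    · have h1 := this hk
      simp only [QOp.onQubit, monomialOp, Matrix.of_apply, if_pos hk, if_neg hxy]
      generalize x q = a at *
      generalize y q = b at *
      fin_cases a <;> fin_cases b <;> simp_all [phaseGate]
    · simp only [QOp.onQubit, monomialOp, Matrix.of_apply, if_neg hk, if_neg hxy]

lemma CX_eq_monomialOp (i j : Fin N) :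
    QOp.CX i j = monomialOp (fun y => Function.update y j (y j + y i)) fun _ => 1 := rfl

lemma ccz_eq_monomialOp (l m n : Fin 3) : ccz l m n = monomialOp (fun y => y)
    fun x => if x l = 1 ∧ x m = 1 ∧ x n = 1 then -1 else 1 := by
  ext x y
  by_cases h : x = y <;> simp [ccz, monomialOp, h]

/-- Rests on the identity 4abc = a + b + c - (a⊕b) - (a⊕c) - (b⊕c) + (a⊕b⊕c), with `t ^ 4 = -1` and
`t' = t⁻¹`. Reading from the right, qubit `n` runs through the parities c, b⊕c, a⊕b⊕c, a⊕c and back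
to c, receiving a phase at each of the first four; the last CNOT puts a⊕b on `m`, as the Peres
operator requires. -/
lemma peresZ_eq {l m n : Fin 3} (hlm : l ≠ m) (hln : l ≠ n) (hmn : m ≠ n) {t t' : ℂ}
    (ht : t * t' = 1) (ht4 : t ^ 4 = -1) :
    QOp.onQubit m (phaseGate t') * (QOp.CX l m * (QOp.CX l n * (QOp.onQubit n (phaseGate t') *
      (QOp.CX m n * (QOp.onQubit n (phaseGate t) * (QOp.CX l n * (QOp.onQubit n (phaseGate t') *
      (QOp.CX m n * (QOp.onQubit l (phaseGate t) * (QOp.onQubit m (phaseGate t) *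
      QOp.onQubit n (phaseGate t))))))))))) = peresZ l m n := by
  simp only [peresZ, onQubit_phaseGate, CX_eq_monomialOp, ccz_eq_monomialOp, monomialOp_mul]
  have h2 : ∀ a : Fin 2, a = 0 ∨ a = 1 := by decide
  congr 1
  · ext y : 1
    rw [funext_iff, forall_iff hlm hln hmn]
    simp only [Function.update_self, Function.update_of_ne hlm, Function.update_of_ne hln,
      Function.update_of_ne hmn, Function.update_of_ne hmn.symm, true_and]
    rcases h2 (y l) with e1 | e1 <;> rcases h2 (y m) with e2 | e2 <;>
      rcases h2 (y n) with e3 | e3 <;> simp [e1, e2, e3]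
  · ext y
    simp only [Function.update_self, Function.update_of_ne hln, Function.update_of_ne hmn]
    rcases h2 (y l) with e1 | e1 <;> rcases h2 (y m) with e2 | e2 <;>
      rcases h2 (y n) with e3 | e3 <;> simp [e1, e2, e3] <;>
      -- The phases cancel unless all three bits are 1, when `t ^ 4` remains.
      first | linear_combination (t * t' + 1) * ht | linear_combination ht4

/-- A unitary phase gate. -/
noncomputable def phaseGateU (t : ℂ) (ht : t * star t = 1) : Matrix.unitaryGroup (Fin 2) ℂ :=
  ⟨phaseGate t, by
    rw [Matrix.mem_unitaryGroup_iff]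
    have : t * (starRingEnd ℂ) t = 1 := ht
    ext i j
    fin_cases i <;> fin_cases j <;>
      simp [phaseGate, Matrix.mul_apply, Matrix.star_apply, this]⟩

lemma exists_eighth_root : ∃ t : ℂ, t * star t = 1 ∧ t ^ 4 = -1 := by
  refine ⟨Complex.exp (Real.pi / 4 * Complex.I), ?_, ?_⟩
  · rw [Complex.star_def, Complex.mul_conj, Complex.normSq_eq_norm_sq, ← Complex.ofReal_ofNat,
      ← Complex.ofReal_div, Complex.norm_exp_ofReal_mul_I]
    simp
  · rw [← Complex.exp_nat_mul, ← Complex.exp_pi_mul_I]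
    congr 1
    push_cast
    ring

theorem exists_cnot_circuit {l m n : Fin 3} (hlm : l ≠ m) (hln : l ≠ n) (hmn : m ≠ n) :
    ∃ c : QCircuit 3, c.IsCNOTCircuit ∧ c.toOp = QOp.PERES l m n ∧ c.numCNOT = 5 := by
  obtain ⟨t, ht, ht4⟩ := exists_eighth_root
  have ht' : star t * star (star t) = 1 := by rw [star_star, mul_comm, ht]
  -- The list is in product order, so its last gate acts first. For the phase `t` on the unit
  -- circle, `star t` is the inverse.
  refine ⟨[.single n hadamardU, .single m (phaseGateU _ ht'), .cnot l m hlm, .cnot l n hln,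
    .single n (phaseGateU _ ht'), .cnot m n hmn, .single n (phaseGateU t ht), .cnot l n hln,
    .single n (phaseGateU _ ht'), .cnot m n hmn, .single l (phaseGateU t ht),
    .single m (phaseGateU t ht), .single n (phaseGateU t ht), .single n hadamardU], ?_, ?_, ?_⟩
  · simp [QCircuit.IsCNOTCircuit, QGate.isSingle, QGate.isCNOT]
  · have h := peresZ_eq hlm hln hmn ht ht4
    have hh := onQubit_hadamard_mul_self hln.symm hmn.symm hlm
    have hp : QOp.PERES l m n =
        QOp.onQubit n hadamardGate * peresZ l m n * QOp.onQubit n hadamardGate := by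
      rw [← hadamard_conj_PERES hlm hln hmn]
      simp only [← mul_assoc, hh, one_mul]
      rw [mul_assoc, hh, mul_one]
    rw [hp, ← h]
    simp [QCircuit.toOp, QGate.toOp, hadamardU, phaseGateU, mul_assoc]
  · simp [QCircuit.numCNOT, List.countP_cons, QGate.isCNOT]

end UpperBound

theorem mainTheorem10 (l m n : Fin 3) (hlm : l ≠ m) (hln : l ≠ n) (hmn : m ≠ n) :
    czCost (QOp.PERES l m n) = 5 ∧ cnotCost (QOp.PERES l m n) = 5 := by
  obtain ⟨c, hc, hop, hnum⟩ := exists_cnot_circuit hlm hln hmn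
  refine ⟨le_antisymm ?_ ?_, le_antisymm ?_ ?_⟩
  · refine (iInf₂_le (c.flatMap QGate.toCZ)
      ⟨isCZCircuit_flatMap_toCZ hc, (toOp_flatMap_toCZ c).trans hop⟩).trans ?_
    rw [numCZ_flatMap_toCZ hc, hnum]
    rfl
  · refine le_iInf₂ fun d hd => ?_
    exact_mod_cast five_le_numCZ hlm hln hmn d hd.1 hd.2
  · refine (iInf₂_le c ⟨hc, hop⟩).trans ?_
    rw [hnum]
    rfl
  · refine le_iInf₂ fun d hd => ?_
    rw [← numCZ_flatMap_toCZ hd.1]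
    exact_mod_cast five_le_numCZ hlm hln hmn _ (isCZCircuit_flatMap_toCZ hd.1)
      ((toOp_flatMap_toCZ d).trans hd.2)
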